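/- Let $\Sigma$ and $\mathcal X$ be finite alphabets (possibly overlapping). A substitution is a map $\sigma:\mathcal X\to 2^{\Sigma^*}$, extended to $\Sigma\cup\mathcal X$ by $\sigma(a)=\{a\}$ for $a\in\Sigma\setminus\mathcal X$. For a finite word, $\sigma(a_1\cdots a_n)=\sigma(a_1)\cdots\sigma(a_n)$; for an infinite word, $\sigma(a_0a_1\cdots)$ is the set of all words $u_0u_1u_2\cdots$ with $u_i\in\sigma(a_i)$ for all $i$; and $\sigma(L)=\bigcup_{w\in L}\sigma(w)$. Write $\Delta^\infty=\Delta^*\cup\Delta^\omega$. A set $L\subseteq\Delta^\infty$ is regular if $L\cap\Delta^*$ is accepted by a finite automaton and $L\cap\Delta^\omega$ by a Büchi automaton. Write $\sigma\le\sigma'$ if $\sigma(x)\subseteq\sigma'(x)$ for all $x\in\mathcal X$. **Proposition.** Let $L\subseteq(\Sigma\cup\mathcal X)^\infty$ and $R\subseteq\Sigma^\infty$ be regular, and let $\sigma_1,\sigma_2:\mathcal X\to 2^{\Sigma^+}$ be such that $\sigma_1(x)$ and $\sigma_2(x)$ are regular languages of nonempty finite words for every $x\in\mathcal X$. Let $\#\in\{\subseteq,=\}$.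 A solution is a substitution $\sigma$ with $\sigma(L)\mathrel{\#}R$ and $\sigma_1\le\sigma\le\sigma_2$. 1. It is decidable, on input $\Sigma$, $\mathcal X$ and automata describing $L,R,\sigma_1,\sigma_2$, whether a solution exists. 2. Every solution $\sigma$ satisfies $\sigma\le\tilde\sigma$ for some maximal solution $\tilde\sigma$ (a solution such that $\tilde\sigma\le\sigma'$ implies $\tilde\sigma=\sigma'$ for every solution $\sigma'$). There are only finitely many maximal solutions. If $\sigma$ is a maximal solution, then $\sigma(x)$ is regular for every $x\in\mathcal X$. All maximal solutions are effectively computable: there is an algorithm which, on input $\Sigma$, $\mathcal X$ and automata describing $L,R,\sigma_1,\sigma_2$, outputs a finite list of tuples of finite automata describing exactly the maximal solutions. -/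

import Mathlib

/-- A finite or infinite word over `α`, i.e. an element of `α^∞ = α^* ∪ α^ω`. -/
inductive InfWord (α : Type*) where
  | fin (w : List α) : InfWord α
  | inf (w : ℕ → α) : InfWord α

/-- All letters of the word belong to `Γ`, i.e. the word belongs to `Γ^∞`. -/
def InfWord.Over {α : Type*} (Γ : Set α) : InfWord α → Prop
  | .fin w => ∀ a ∈ w, a ∈ Γ
  | .inf w => ∀ n, w n ∈ Γ

/-- The language of infinite words accepted by a nondeterministic automaton with the Büchi
condition: there is an infinite path labelled by the word which begins in an initial state and
visits some accepting state infinitely often. -/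
def buchiLanguage {α Q : Type*} (M : NFA α Q) : Set (ℕ → α) :=
  {w | ∃ r : ℕ → Q, r 0 ∈ M.start ∧ (∀ n, r (n + 1) ∈ M.step (r n) (w n)) ∧
    ∃ q ∈ M.accept, ∃ᶠ n in Filter.atTop, r n = q}

/-- `ω`-regular languages: those accepted by a Büchi automaton with finitely many states. -/
def IsOmegaRegular {α : Type*} (L : Set (ℕ → α)) : Prop :=
  ∃ (Q : Type) (_ : Fintype Q) (M : NFA α Q), buchiLanguage M = L

/-- Regular languages of finite and infinite words: the finite words of `L` form a regular
language and the infinite words of `L` form an `ω`-regular language. -/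
def IsRegularInf {α : Type*} (L : Set (InfWord α)) : Prop :=
  Language.IsRegular ({w | InfWord.fin w ∈ L} : Language α) ∧
    IsOmegaRegular {w : ℕ → α | InfWord.inf w ∈ L}

/-- The concatenation `v 0 ++ v 1 ++ ... ++ v (n - 1)`. -/
def partialConcat {α : Type*} (v : ℕ → List α) (n : ℕ) : List α :=
  (List.range n).flatMap v

/-- `IsConcat v w`: the word `w` is the infinite concatenation `v 0 ++ v 1 ++ v 2 ++ ...`.
It is a finite word exactly if almost all of the `v i` are empty. -/
def IsConcat {α : Type*} (v : ℕ → List α) : InfWord α → Prop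
  | .fin w => ∃ N, ∀ n, N ≤ n → partialConcat v n = w
  | .inf w => (∀ m, ∃ n, m ≤ (partialConcat v n).length) ∧
      ∀ n i (h : i < (partialConcat v n).length), (partialConcat v n)[i] = w i

/-- The extension of a substitution `σ` on the variables `X` to all letters:
a letter which is not a variable is mapped to `{a}`. -/
def substLetter {α : Type*} {X : Set α} (σ : X → Language α) (a : α) : Language α :=
  {u | (∃ h : a ∈ X, u ∈ σ ⟨a, h⟩) ∨ (a ∉ X ∧ u = [a])}

/-- The set `σ(w)` for a finite or infinite word `w`: choose, independently for each position,
a word in the image of the letter at that position, and concatenate. -/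
def substWord {α : Type*} {X : Set α} (σ : X → Language α) : InfWord α → Set (InfWord α)
  | .fin w => {u | ∃ v : List (List α),
      List.Forall₂ (fun a s => s ∈ substLetter σ a) w v ∧ u = .fin v.flatten}
  | .inf w => {u | ∃ v : ℕ → List α, (∀ i, v i ∈ substLetter σ (w i)) ∧ IsConcat v u}

/-- The set `σ(L)`. -/
def substLang {α : Type*} {X : Set α} (σ : X → Language α) (L : Set (InfWord α)) :
    Set (InfWord α) :=
  {u | ∃ w ∈ L, u ∈ substWord σ w}

/-- The two relations `⊆` and `=` between languages. -/
inductive MatchRel where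
  | sub : MatchRel
  | eq : MatchRel

def MatchRel.Holds {β : Type*} : MatchRel → Set β → Set β → Prop
  | .sub, A, B => A ⊆ B
  | .eq, A, B => A = B

/-- The data of a matching problem: alphabet `Sig` of the target words, set `X` of variables
(`Sig` and `X` may overlap), languages `L` and `R`, lower and upper constraints. -/
structure MatchingProblem (α : Type*) where
  Sig : Set α
  X : Set α
  L : Set (InfWord α)
  R : Set (InfWord α)
  lower : X → Language α
  upper : X → Language α

namespace MatchingProblem

/-- The alphabets are finite, `L ⊆ (Sig ∪ X)^∞`, `R ⊆ Sig^∞`, and the constraints assign to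
each variable a set of nonempty finite words over `Sig`. -/
structure WellFormed {α : Type*} (P : MatchingProblem α) : Prop where
  finite_Sig : P.Sig.Finite
  finite_X : P.X.Finite
  L_over : ∀ w ∈ P.L, w.Over (P.Sig ∪ P.X)
  R_over : ∀ w ∈ P.R, w.Over P.Sig
  lower_over : ∀ x, ∀ u ∈ P.lower x, u ≠ [] ∧ ∀ a ∈ u, a ∈ P.Sig
  upper_over : ∀ x, ∀ u ∈ P.upper x, u ≠ [] ∧ ∀ a ∈ u, a ∈ P.Sig

/-- All languages of the problem are regular. -/
structure Regular {α : Type*} (P : MatchingProblem α) : Prop where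
  L_reg : IsRegularInf P.L
  R_reg : IsRegularInf P.R
  lower_reg : ∀ x, (P.lower x).IsRegular
  upper_reg : ∀ x, (P.upper x).IsRegular

/-- `σ` is a solution: `σ(L) # R`, and `lower x ⊆ σ x ⊆ upper x` for all variables `x`.
For a well-formed problem the last inclusion gives `σ x ⊆ Sig^+`. -/
def IsSolution {α : Type*} (P : MatchingProblem α) (rel : MatchRel)
    (σ : P.X → Language α) : Prop :=
  rel.Holds (substLang σ P.L) P.R ∧ ∀ x, P.lower x ≤ σ x ∧ σ x ≤ P.upper x

end MatchingProblem

/-! Finite descriptions, the inputs and outputs of algorithms. -/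

/-- A finite automaton, written down as the list of its transitions `(p, a, q)`, the list of its
initial states and the list of its accepting states; states are natural numbers. -/
abbrev AutCode (α : Type*) := List (ℕ × α × ℕ) × List ℕ × List ℕ

def AutCode.toNFA {α : Type*} (A : AutCode α) : NFA α ℕ where
  step p a := {q | (p, a, q) ∈ A.1}
  start := {q | q ∈ A.2.1}
  accept := {q | q ∈ A.2.2}

/-- A regular language of finite and infinite words, given by an automaton for its finite words
and a Büchi automaton for its infinite words. -/
abbrev InfLangCode (α : Type*) := AutCode α × AutCode α

def InfLangCode.lang {α : Type*} (C : InfLangCode α) : Set (InfWord α)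
  | .fin w => w ∈ (AutCode.toNFA C.1).accepts
  | .inf w => w ∈ buchiLanguage (AutCode.toNFA C.2)

/-- A regular substitution, given by a list of pairs of a variable and an automaton. -/
abbrev SubstCode (α : Type*) := List (α × AutCode α)

/-- The language of a variable is the union of the languages of the automata listed for it. -/
def SubstCode.toSubst {α : Type*} (S : SubstCode α) (X : Set α) : X → Language α :=
  fun x => {w | ∃ A : AutCode α, (x.1, A) ∈ S ∧ w ∈ A.toNFA.accepts}

/-- An input: the alphabets `Sig` and `X`, descriptions of `L` and `R`, and descriptions of the
lower and of the upper constraint. -/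
abbrev ProblemCode (α : Type*) :=
  (List α × List α) × (InfLangCode α × InfLangCode α) × (SubstCode α × SubstCode α)

/-- The matching problem which an input describes. -/
def ProblemCode.toProblem {α : Type*} (I : ProblemCode α) : MatchingProblem α where
  Sig := {a | a ∈ I.1.1}
  X := {a | a ∈ I.1.2}
  L := InfLangCode.lang I.2.1.1
  R := InfLangCode.lang I.2.1.2
  lower := SubstCode.toSubst I.2.2.1 {a | a ∈ I.1.2}
  upper := SubstCode.toSubst I.2.2.2 {a | a ∈ I.1.2}

/-! Fix automata for `R` and give each finite word its path type: the pairs of states it joins,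
together with whether a path between them can visit an accepting state. There are finitely many
types, they are compatible with concatenation, and replacing the factors of a word by factors of the
same type does not affect membership in `R`; for infinite words the factors must be nonempty
(`NFA.pathType_flatten`, `NFA.mem_buchiLanguage_congr`). A solution can therefore be enlarged,
inside the upper constraint, by all words whose type it already uses: the image stays inside `R`,
and in the case of equality it still covers `R` by monotonicity
(`MatchingProblem.IsSolution.of_saturated`). The enlarged solutions are intersections of the upper
constraint with unions of type classes. They are finitely many and regular, and every solution lies
below one of them, which gives the structure of the maximal solutions (`exists_maximal_of_finite`).

For the algorithms the argument is repeated with coded automata, whose states are natural numbers,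
and with types tabulated as lists (`jointType`). Every type has a representative of bounded length,
so all saturated candidates can be listed (`ProblemCode.exists_candidate`). Testing a candidate
amounts to inclusion tests between its image and `R`. The image has an explicit automaton
(`SubstCode.mem_accepts_substAut`, `SubstCode.mem_buchiLanguage_substAut`). Inclusion is decided on
short words (`AutCode.inclFin_iff`), or, for infinite words, on ultimately periodic words with short
period and prefix, to which Ramsey's theorem reduces the general case (`AutCode.inclBuchi_iff`).
Every search is bounded, so all procedures are primitive recursive. -/

open Filter

/-! ### Factorizations of infinite words. -/

section Slices

variable {α : Type*}

/-- The factor `w m, ..., w (n - 1)` of an infinite word. -/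
def slice (w : ℕ → α) (m n : ℕ) : List α :=
  (List.range' m (n - m)).map w

@[simp] theorem slice_self (w : ℕ → α) (m : ℕ) : slice w m m = [] := by
  simp [slice]

@[simp] theorem length_slice (w : ℕ → α) (m n : ℕ) : (slice w m n).length = n - m := by
  simp [slice]

theorem slice_eq_cons (w : ℕ → α) {m n : ℕ} (h : m < n) :
    slice w m n = w m :: slice w (m + 1) n := by
  obtain ⟨k, rfl⟩ := Nat.exists_eq_add_of_lt h
  have h1 : m + k + 1 - m = k + 1 := by omega
  have h2 : m + k + 1 - (m + 1) = k := by omega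
  simp [slice, h1, h2, List.range'_succ]

theorem slice_append_slice (w : ℕ → α) {m n k : ℕ} (h : m ≤ n) (h' : n ≤ k) :
    slice w m n ++ slice w n k = slice w m k := by
  obtain ⟨a, rfl⟩ := Nat.exists_eq_add_of_le h
  obtain ⟨b, rfl⟩ := Nat.exists_eq_add_of_le h'
  have h1 : m + a + b - m = a + b := by omega
  simp [slice, h1, ← List.map_append]

theorem slice_ne_nil (w : ℕ → α) {m n : ℕ} (h : m < n) : slice w m n ≠ [] := by
  simp [slice_eq_cons w h]

theorem mem_slice {w : ℕ → α} {m n : ℕ} {a : α} :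
    a ∈ slice w m n ↔ ∃ k, m ≤ k ∧ k < n ∧ w k = a := by
  simp only [slice, List.mem_map, List.mem_range'_1]
  constructor
  · rintro ⟨k, hk, rfl⟩
    exact ⟨k, hk.1, by omega, rfl⟩
  · rintro ⟨k, h1, h2, rfl⟩
    exact ⟨k, ⟨h1, by omega⟩, rfl⟩

theorem getElem_slice (w : ℕ → α) (m n i : ℕ) (h : i < (slice w m n).length) :
    (slice w m n)[i] = w (m + i) := by
  simp [slice]

theorem partialConcat_succ (v : ℕ → List α) (n : ℕ) :
    partialConcat v (n + 1) = partialConcat v n ++ v n := by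
  simp [partialConcat, List.range_succ]

@[simp] theorem partialConcat_zero (v : ℕ → List α) : partialConcat v 0 = [] := rfl

/-- The position at which the `n`-th factor begins in the concatenation of the words `v i`. -/
def concatPos (v : ℕ → List α) (n : ℕ) : ℕ := (partialConcat v n).length

@[simp] theorem concatPos_zero (v : ℕ → List α) : concatPos v 0 = 0 := rfl

theorem concatPos_succ (v : ℕ → List α) (n : ℕ) :
    concatPos v (n + 1) = concatPos v n + (v n).length := by
  simp [concatPos, partialConcat_succ]

theorem concatPos_strictMono {v : ℕ → List α} (hv : ∀ i, v i ≠ []) :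
    StrictMono (concatPos v) :=
  strictMono_nat_of_lt_succ fun n => by
    have := List.length_pos_iff.2 (hv n)
    rw [concatPos_succ]; omega

theorem slice_concatPos {v : ℕ → List α} {z : ℕ → α} (h : IsConcat v (.inf z)) (i : ℕ) :
    slice z (concatPos v i) (concatPos v (i + 1)) = v i := by
  apply List.ext_getElem
  · simp [concatPos_succ]
  · intro k h1 h2
    have h3 : concatPos v i + k < (partialConcat v (i + 1)).length := by
      have : (partialConcat v (i + 1)).length = concatPos v i + (v i).length :=
        concatPos_succ v i
      omega
    have h4 := h.2 (i + 1) _ h3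
    rw [getElem_slice, ← h4]
    simp [partialConcat_succ, concatPos]

theorem isConcat_of_slices {v : ℕ → List α} {z : ℕ → α} {pos : ℕ → ℕ} (hp : StrictMono pos)
    (h0 : pos 0 = 0) (h : ∀ i, v i = slice z (pos i) (pos (i + 1))) :
    IsConcat v (.inf z) := by
  have key : ∀ n, partialConcat v n = slice z 0 (pos n) := by
    intro n
    induction n with
    | zero => simp [h0]
    | succ n ih =>
      rw [partialConcat_succ, ih, h, slice_append_slice _ (Nat.zero_le _) (hp n.lt_succ_self).le]
  refine ⟨fun m => ⟨m, by rw [key]; simpa using hp.id_le m⟩, fun n i hi => ?_⟩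
  have : i < (slice z 0 (pos n)).length := by rw [← key]; exact hi
  have h2 := getElem_slice z 0 (pos n) i this
  simp only [key, h2, zero_add]

/-- As no factor is empty, the first `n + 1` factors cover position `n`, and the letter there is
read off from them. The partial concatenations are prefixes of one another, so the readings agree.
-/
theorem exists_isConcat {v : ℕ → List α} (hv : ∀ i, v i ≠ []) :
    ∃ z : ℕ → α, IsConcat v (.inf z) := by
  have hm := concatPos_strictMono hv
  have hlt : ∀ n, n < (partialConcat v (n + 1)).length := fun n => hm.id_le (n + 1)
  have hpre : ∀ m k, partialConcat v m <+: partialConcat v (m + k) := by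
    intro m k
    induction k with
    | zero => exact List.prefix_rfl
    | succ k ih =>
      rw [← Nat.add_assoc, partialConcat_succ]
      exact ih.trans (List.prefix_append _ _)
  refine ⟨fun n => (partialConcat v (n + 1))[n]'(hlt n), fun m => ⟨m, hm.id_le m⟩, ?_⟩
  intro n i hi
  rcases le_total n (i + 1) with h | h
  · obtain ⟨k, hk⟩ := Nat.exists_eq_add_of_le h
    have h2 := hpre n k
    rw [← hk] at h2
    exact h2.getElem hi
  · obtain ⟨k, hk⟩ := Nat.exists_eq_add_of_le h
    have h2 := hpre (i + 1) k
    rw [← hk] at h2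
    exact (h2.getElem (hlt i)).symm

theorem not_isConcat_fin {v : ℕ → List α} (hv : ∀ i, v i ≠ []) (u : List α) :
    ¬ IsConcat v (.fin u) := by
  rintro ⟨N, hN⟩
  have h1 := hN N le_rfl
  have h2 := hN (N + 1) (Nat.le_succ N)
  have h3 := concatPos_strictMono hv N.lt_succ_self
  simp [concatPos, h1, h2] at h3

theorem exists_mem_block {pos : ℕ → ℕ} (hp : StrictMono pos) (h0 : pos 0 = 0) (n : ℕ) :
    ∃ i, pos i ≤ n ∧ n < pos (i + 1) := by
  induction n with
  | zero => exact ⟨0, h0.le, by have := hp Nat.zero_lt_one; simp only [zero_add]; omega⟩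
  | succ n ih =>
    obtain ⟨i, h1, h2⟩ := ih
    rcases (Nat.succ_le_of_lt h2).lt_or_eq with h | h
    · exact ⟨i, by omega, h⟩
    · exact ⟨i + 1, h.ge, by have := hp (Nat.lt_add_one (i + 1)); omega⟩

theorem block_unique {pos : ℕ → ℕ} (hp : StrictMono pos) {n i j : ℕ} (h1 : pos i ≤ n)
    (h2 : n < pos (i + 1)) (h3 : pos j ≤ n) (h4 : n < pos (j + 1)) : i = j := by
  have h5 := hp.lt_iff_lt.1 (h1.trans_lt h4)
  have h6 := hp.lt_iff_lt.1 (h3.trans_lt h2)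
  omega

end Slices

/-! ### Paths in automata and block-wise Büchi acceptance. -/

section Reach

variable {α Q : Type*}

/-- There is a path from `p` to `q` labelled by the word; if `b` is true then some state of the
path is accepting. -/
def NFA.Reach (M : NFA α Q) : Bool → Q → List α → Q → Prop
  | b, p, [], q => p = q ∧ (b = true → p ∈ M.accept)
  | b, p, a :: w, q => ∃ b' : Bool, (b = true → b' = true ∨ p ∈ M.accept) ∧
      ∃ r ∈ M.step p a, NFA.Reach M b' r w q

namespace NFA

variable {M : NFA α Q}

theorem Reach.mono {b b' : Bool} {p q : Q} {w : List α} (h : M.Reach b p w q)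
    (hb : b' = true → b = true) : M.Reach b' p w q := by
  cases w with
  | nil => exact ⟨h.1, fun h' => h.2 (hb h')⟩
  | cons a w =>
    obtain ⟨c, hc, h⟩ := h
    exact ⟨c, fun h' => hc (hb h'), h⟩

theorem Reach.false {b : Bool} {p q : Q} {w : List α} (h : M.Reach b p w q) :
    M.Reach false p w q := h.mono (by simp)

theorem reach_append {b : Bool} {p q : Q} {u v : List α} :
    M.Reach b p (u ++ v) q ↔ ∃ (r : Q) (b₁ b₂ : Bool), (b = true → b₁ = true ∨ b₂ = true) ∧
      M.Reach b₁ p u r ∧ M.Reach b₂ r v q := by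
  induction u generalizing b p with
  | nil =>
    constructor
    · intro h
      exact ⟨p, false, b, by simp, ⟨rfl, by simp⟩, h⟩
    · rintro ⟨r, b₁, b₂, hb, ⟨rfl, h1⟩, h2⟩
      cases v with
      | nil => exact ⟨h2.1, fun h => (hb h).elim h1 h2.2⟩
      | cons a v =>
        obtain ⟨c, hc, h2⟩ := h2
        exact ⟨c, fun h => (hb h).elim (fun h' => .inr (h1 h')) hc, h2⟩
  | cons a u ih =>
    constructor
    · rintro ⟨c, hc, r, hr, h⟩
      obtain ⟨s, b₁, b₂, hb, h1, h2⟩ := ih.1 h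
      -- The prefix claims an accepting visit only if its tail has one or the suffix claims none; in
      -- the latter case the visit must lie at `p` or in `u`.
      refine ⟨s, b && (b₁ || decide (b₂ = Bool.false)), b₂, ?_, ⟨b₁, ?_, r, hr, h1⟩, h2⟩
      · intro h
        cases b₂ <;> simp_all
      · intro h
        simp only [Bool.and_eq_true, Bool.or_eq_true, decide_eq_true_eq] at h
        rcases hc h.1 with h' | h'
        · rcases hb h' with h'' | h''
          · exact .inl h''
          · exact .inl (by simpa [h''] using h.2)
        · exact .inr h'
    · rintro ⟨s, b₁, b₂, hb, ⟨c, hc, r, hr, h1⟩, h2⟩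
      refine ⟨c || b₂, ?_, r, hr, ih.2 ⟨s, c, b₂, by simp, h1, h2⟩⟩
      intro h
      rcases hb h with h' | h'
      · rcases hc h' with h'' | h''
        · simp [h'']
        · exact .inr h''
      · simp [h']

theorem Reach.append {b₁ b₂ : Bool} {p q r : Q} {u v : List α} (h : M.Reach b₁ p u r)
    (h' : M.Reach b₂ r v q) : M.Reach (b₁ || b₂) p (u ++ v) q :=
  reach_append.2 ⟨r, b₁, b₂, by simp, h, h'⟩

theorem reach_false_append {p q : Q} {u v : List α} :
    M.Reach false p (u ++ v) q ↔ ∃ r, M.Reach false p u r ∧ M.Reach false r v q := by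
  rw [reach_append]
  constructor
  · rintro ⟨r, b₁, b₂, -, h1, h2⟩
    exact ⟨r, h1.false, h2.false⟩
  · rintro ⟨r, h1, h2⟩
    exact ⟨r, false, false, by simp, h1, h2⟩

theorem reach_false_nil {p q : Q} : M.Reach false p [] q ↔ p = q := by
  simp [Reach]

theorem reach_false_cons {p q : Q} {a : α} {w : List α} :
    M.Reach false p (a :: w) q ↔ ∃ r ∈ M.step p a, M.Reach false r w q := by
  constructor
  · rintro ⟨c, -, r, hr, h⟩
    exact ⟨r, hr, h.false⟩
  · rintro ⟨r, hr, h⟩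
    exact ⟨false, by simp, r, hr, h⟩

theorem reach_true_of_start {p q : Q} {w : List α} (hp : p ∈ M.accept)
    (h : M.Reach false p w q) : M.Reach true p w q := by
  have h1 : M.Reach true p [] p := ⟨rfl, fun _ => hp⟩
  simpa using h1.append h

theorem mem_accepts_iff_reach {w : List α} :
    w ∈ M.accepts ↔ ∃ p ∈ M.start, ∃ q ∈ M.accept, M.Reach false p w q := by
  have key : ∀ (w : List α) (S : Set Q) (q : Q),
      q ∈ M.evalFrom S w ↔ ∃ p ∈ S, M.Reach false p w q := by
    intro w
    induction w with
    | nil => intro S q; simp [reach_false_nil]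
    | cons a w ih =>
      intro S q
      rw [evalFrom_cons, ih]
      simp only [mem_stepSet, reach_false_cons]
      constructor
      · rintro ⟨r, ⟨p, hp, hr⟩, h⟩
        exact ⟨p, hp, r, hr, h⟩
      · rintro ⟨p, hp, r, hr, h⟩
        exact ⟨r, ⟨p, hp, hr⟩, h⟩
  rw [mem_accepts]
  simp only [key]
  constructor
  · rintro ⟨q, hq, p, hp, h⟩
    exact ⟨p, hp, q, hq, h⟩
  · rintro ⟨p, hp, q, hq, h⟩
    exact ⟨q, hq, p, hp, h⟩

theorem reach_slice_of_run {r : ℕ → Q} {w : ℕ → α} {m n : ℕ} (hmn : m ≤ n)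
    (hr : ∀ k, m ≤ k → k < n → r (k + 1) ∈ M.step (r k) (w k)) :
    M.Reach false (r m) (slice w m n) (r n) := by
  induction hmn using Nat.decreasingInduction with
  | self => simp [reach_false_nil]
  | of_succ k hk ih =>
    rw [slice_eq_cons _ hk, reach_false_cons]
    exact ⟨_, hr k le_rfl hk, ih fun j hj => hr j (by omega)⟩

theorem reach_true_slice_of_run {r : ℕ → Q} {w : ℕ → α} {m n k : ℕ} (hmk : m ≤ k) (hkn : k ≤ n)
    (hr : ∀ k, m ≤ k → k < n → r (k + 1) ∈ M.step (r k) (w k)) (hk : r k ∈ M.accept) :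
    M.Reach true (r m) (slice w m n) (r n) := by
  rw [← slice_append_slice w hmk hkn]
  exact (reach_slice_of_run hmk fun j h1 h2 => hr j h1 (by omega)).append
    (reach_true_of_start hk (reach_slice_of_run hkn fun j h1 h2 => hr j (by omega) h2))

theorem run_of_reach_slice {b : Bool} {w : ℕ → α} {m n : ℕ} (hmn : m ≤ n) {p q : Q}
    (h : M.Reach b p (slice w m n) q) :
    ∃ r : ℕ → Q, r m = p ∧ r n = q ∧ (∀ k, m ≤ k → k < n → r (k + 1) ∈ M.step (r k) (w k)) ∧
      (b = true → ∃ k, m ≤ k ∧ k ≤ n ∧ r k ∈ M.accept) := by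
  induction hmn using Nat.decreasingInduction generalizing b p with
  | self =>
    rw [slice_self] at h
    exact ⟨fun _ => p, rfl, h.1, fun k h1 h2 => by omega, fun hb => ⟨n, le_rfl, le_rfl, h.2 hb⟩⟩
  | of_succ k hk ih =>
    rw [slice_eq_cons _ hk] at h
    obtain ⟨c, hc, s, hs, h⟩ := h
    obtain ⟨r, h1, h2, h3, h4⟩ := ih h
    refine ⟨fun j => if j ≤ k then p else r j, by simp, by simp [h2]; omega, ?_, ?_⟩
    · intro j hj hjn
      rcases hj.eq_or_lt with rfl | hj
      · simpa [h1] using hs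
      · have h5 : ¬ j + 1 ≤ k := by omega
        have h6 : ¬ j ≤ k := by omega
        simpa [h5, h6] using h3 j hj hjn
    · intro hb
      rcases hc hb with h' | h'
      · obtain ⟨j, h5, h6, h7⟩ := h4 h'
        have h8 : ¬ j ≤ k := by omega
        exact ⟨j, by omega, h6, by simpa [h8] using h7⟩
      · exact ⟨k, le_rfl, hk.le, by simpa using h'⟩

/-- By definition one fixed accepting state recurs; with finitely many accepting states the
pigeonhole principle supplies it. -/
theorem mem_buchiLanguage_iff {M : NFA α Q} (hM : M.accept.Finite) {w : ℕ → α} :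
    w ∈ buchiLanguage M ↔ ∃ r : ℕ → Q, r 0 ∈ M.start ∧
      (∀ n, r (n + 1) ∈ M.step (r n) (w n)) ∧ ∃ᶠ n in atTop, r n ∈ M.accept := by
  constructor
  · rintro ⟨r, h0, h1, q, hq, h2⟩
    exact ⟨r, h0, h1, h2.mono fun n hn => hn ▸ hq⟩
  · rintro ⟨r, h0, h1, h2⟩
    refine ⟨r, h0, h1, ?_⟩
    by_contra! h
    refine h2 ?_
    have : ∀ᶠ n in atTop, ∀ q ∈ M.accept, r n ≠ q :=
      (Filter.eventually_all_finite hM).2 fun q hq => by simpa using h q hq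
    exact this.mono fun n hn hn' => hn _ hn' rfl

/-- Acceptance by a Büchi automaton can be read off from any factorization of the word. -/
theorem mem_buchiLanguage_iff_blocks {M : NFA α Q} (hM : M.accept.Finite) {w : ℕ → α}
    {pos : ℕ → ℕ} (hp : StrictMono pos) (h0 : pos 0 = 0) :
    w ∈ buchiLanguage M ↔ ∃ s : ℕ → Q, s 0 ∈ M.start ∧
      (∀ i, M.Reach false (s i) (slice w (pos i) (pos (i + 1))) (s (i + 1))) ∧
      ∃ᶠ i in atTop, M.Reach true (s i) (slice w (pos i) (pos (i + 1))) (s (i + 1)) := by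
  rw [mem_buchiLanguage_iff hM]
  constructor
  · rintro ⟨r, h1, h2, h3⟩
    refine ⟨fun i => r (pos i), by simpa [h0] using h1, fun i =>
      reach_slice_of_run (hp i.lt_succ_self).le fun k _ _ => h2 k, ?_⟩
    rw [frequently_atTop] at h3 ⊢
    intro N
    obtain ⟨n, hn, hacc⟩ := h3 (pos N)
    obtain ⟨i, hi, hi'⟩ := exists_mem_block hp h0 n
    have : N < i + 1 := hp.lt_iff_lt.1 (hn.trans_lt hi')
    exact ⟨i, by omega, reach_true_slice_of_run hi hi'.le (fun k _ _ => h2 k) hacc⟩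
  · rintro ⟨s, h1, h2, h3⟩
    classical
    -- Each block gets a local run, with an accepting visit whenever the block admits one.
    -- Consecutive local runs agree at their common boundary, so they can be glued.
    have hex : ∀ i, ∃ r : ℕ → Q, r (pos i) = s i ∧ r (pos (i + 1)) = s (i + 1) ∧
        (∀ k, pos i ≤ k → k < pos (i + 1) → r (k + 1) ∈ M.step (r k) (w k)) ∧
        (M.Reach true (s i) (slice w (pos i) (pos (i + 1))) (s (i + 1)) →
          ∃ k, pos i ≤ k ∧ k ≤ pos (i + 1) ∧ r k ∈ M.accept) := by
      intro i
      by_cases h : M.Reach true (s i) (slice w (pos i) (pos (i + 1))) (s (i + 1))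
      · obtain ⟨r, a, b, c, d⟩ := run_of_reach_slice (hp i.lt_succ_self).le h
        exact ⟨r, a, b, c, fun _ => d rfl⟩
      · obtain ⟨r, a, b, c, d⟩ := run_of_reach_slice (hp i.lt_succ_self).le (h2 i)
        exact ⟨r, a, b, c, fun h' => absurd h' h⟩
    choose ρ ha hb hc hd using hex
    choose idx hi hi' using exists_mem_block hp h0
    have hidx : ∀ n i, pos i ≤ n → n < pos (i + 1) → idx n = i := fun n i h h' =>
      block_unique hp (hi n) (hi' n) h h'
    have hval : ∀ n i, pos i ≤ n → n ≤ pos (i + 1) → ρ (idx n) n = ρ i n := by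
      intro n i h h'
      rcases h'.lt_or_eq with h' | h'
      · rw [hidx n i h h']
      · rw [hidx n (i + 1) h'.ge (by have := hp (Nat.lt_add_one (i + 1)); omega), h', ha, hb]
    refine ⟨fun n => ρ (idx n) n, ?_, ?_, ?_⟩
    · have : ρ (idx 0) 0 = ρ 0 0 := hval 0 0 h0.le (Nat.zero_le _)
      have h4 := ha 0
      rw [h0] at h4
      simpa [this, h4] using h1
    · intro n
      have h4 := hval (n + 1) (idx n) ((hi n).trans n.le_succ) (hi' n)
      simp only [h4]
      exact hc (idx n) n (hi n) (hi' n)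
    · rw [frequently_atTop] at h3 ⊢
      intro N
      obtain ⟨i, hNi, h⟩ := h3 N
      obtain ⟨k, hk, hk', hacc⟩ := hd i h
      refine ⟨k, (hNi.trans (hp.id_le i)).trans hk, ?_⟩
      simpa only [hval k i hk hk'] using hacc

end NFA

end Reach

/-! ### Ramsey's theorem by a nonprincipal ultrafilter. -/

section Ramsey

/-- Ramsey's theorem for colourings of the pairs `i < j` with finitely many colours. -/
theorem exists_monochromatic_subsequence {κ : Type*} (c : ℕ → ℕ → κ) {S : Set κ} (hS : S.Finite)
    (hc : ∀ i j, c i j ∈ S) :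
    ∃ (n : ℕ → ℕ) (e : κ), StrictMono n ∧ ∀ i j, i < j → c (n i) (n j) = e := by
  have key : ∀ f : ℕ → κ, (∀ i, f i ∈ S) → ∃ e, ∀ᶠ i in (hyperfilter ℕ : Filter ℕ), f i = e := by
    intro f hf
    have h : ∀ᶠ i in (hyperfilter ℕ : Filter ℕ), f i ∈ S := Eventually.of_forall hf
    have h2 : ∃ e ∈ S, ∀ᶠ i in (hyperfilter ℕ : Filter ℕ), f i = e := by
      by_contra! h3
      have h4 : ∀ᶠ i in (hyperfilter ℕ : Filter ℕ), ∀ e ∈ S, f i ≠ e :=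
        (Filter.eventually_all_finite hS).2 fun e he =>
          h3 e he
      obtain ⟨i, hi⟩ := h4.exists
      exact hi _ (hf i) rfl
    exact h2.imp fun e he => he.2
  -- `d i` is the colour of `(i, j)` for almost all `j`, and `e` will be the value of `d i` for
  -- almost all `i`. Any finite set of indices with `d i = e` then extends by a larger such index
  -- joined to all of them in colour `e`.
  choose d hd using fun i => key (c i) (hc i)
  have hdS : ∀ i, d i ∈ S := fun i => by
    obtain ⟨j, hj⟩ := (hd i).exists
    exact hj ▸ hc i j
  obtain ⟨e, he⟩ := key d hdS
  obtain ⟨n, hn, hn'⟩ := exists_seq_of_forall_finset_exists (fun i => d i = e)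
    (fun i j => i < j ∧ c i j = e) fun s hs => by
      have h1 : ∀ᶠ j in (hyperfilter ℕ : Filter ℕ), ∀ i ∈ s, i < j ∧ c i j = e := by
        refine (Filter.eventually_all_finset s).2 fun i hi => ?_
        have h3 : ∀ᶠ j in (hyperfilter ℕ : Filter ℕ), i < j :=
          Nat.hyperfilter_le_atTop (eventually_gt_atTop i)
        filter_upwards [hd i, h3] with j hj hj'
        exact ⟨hj', by rw [hj, hs i hi]⟩
      obtain ⟨j, hj, hj'⟩ := (he.and h1).exists
      exact ⟨j, hj, hj'⟩
  exact ⟨n, e, fun i j h => (hn' i j h).1, fun i j h => (hn' i j h).2⟩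

end Ramsey

/-! ### The finite congruence given by path types. -/

section PathType

variable {α Q : Type*}

namespace NFA

/-- The pairs of states that are joined by a path labelled by the word, together with the
information whether the path can be chosen to visit an accepting state. -/
def pathType (M : NFA α Q) (w : List α) : Set (Bool × Q × Q) :=
  {t | M.Reach t.1 t.2.1 w t.2.2}

variable {M : NFA α Q}

theorem reach_congr {u v : List α} (h : M.pathType u = M.pathType v) {b : Bool} {p q : Q} :
    M.Reach b p u q ↔ M.Reach b p v q :=
  Set.ext_iff.1 h (b, p, q)

theorem pathType_append {u u' v v' : List α} (h : M.pathType u = M.pathType u')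
    (h' : M.pathType v = M.pathType v') : M.pathType (u ++ v) = M.pathType (u' ++ v') := by
  ext ⟨b, p, q⟩
  change M.Reach b p _ q ↔ M.Reach b p _ q
  simp only [reach_append, reach_congr h, reach_congr h']

theorem pathType_flatten {v v' : List (List α)}
    (h : List.Forall₂ (fun s s' => M.pathType s = M.pathType s') v v') :
    M.pathType v.flatten = M.pathType v'.flatten := by
  induction h with
  | nil => rfl
  | cons h _ ih => simpa using pathType_append h ih

theorem mem_accepts_congr {u v : List α} (h : M.pathType u = M.pathType v) :
    u ∈ M.accepts ↔ v ∈ M.accepts := by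
  simp only [mem_accepts_iff_reach, reach_congr h]

/-- Block-wise acceptance uses of each factor only what its path type records. Nonempty factors make
the block boundaries strictly increasing. -/
theorem mem_buchiLanguage_congr (hM : M.accept.Finite) {v v' : ℕ → List α} {z z' : ℕ → α}
    (hv : ∀ i, v i ≠ []) (hv' : ∀ i, v' i ≠ []) (h : ∀ i, M.pathType (v i) = M.pathType (v' i))
    (hz : IsConcat v (.inf z)) (hz' : IsConcat v' (.inf z')) :
    z ∈ buchiLanguage M ↔ z' ∈ buchiLanguage M := by
  rw [mem_buchiLanguage_iff_blocks hM (concatPos_strictMono hv) (concatPos_zero v),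
    mem_buchiLanguage_iff_blocks hM (concatPos_strictMono hv') (concatPos_zero v')]
  simp only [slice_concatPos hz, slice_concatPos hz', reach_congr (h _)]

/-- A word which, up to the types of its factors, has the form `u v v v ...` with an idempotent
`v` absorbed by `u`, is accepted if and only if there is an accepting lasso along `u` and `v`. -/
theorem mem_buchiLanguage_iff_lasso (hM : M.accept.Finite) {D : Set Q} (hD : D.Finite)
    (hstep : ∀ p a, ∀ q ∈ M.step p a, q ∈ D) {z : ℕ → α} {pos : ℕ → ℕ} (hp : StrictMono pos)
    (h0 : pos 0 = 0) {u v : List α}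
    (hu : ∀ i, 1 ≤ i → M.pathType (slice z 0 (pos i)) = M.pathType u)
    (hv : ∀ i j, 1 ≤ i → i < j → M.pathType (slice z (pos i) (pos j)) = M.pathType v) :
    z ∈ buchiLanguage M ↔
      ∃ p ∈ M.start, ∃ q, M.Reach false p u q ∧ M.Reach true q v q := by
  rw [mem_buchiLanguage_iff_blocks hM hp h0]
  constructor
  · rintro ⟨s, h1, h2, h3⟩
    have hseg : ∀ i j, i ≤ j → M.Reach false (s i) (slice z (pos i) (pos j)) (s j) := by
      intro i j hij
      induction j, hij using Nat.le_induction with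
      | base => simp [reach_false_nil]
      | succ j hij ih =>
        rw [← slice_append_slice z (hp.monotone hij) (hp.monotone j.le_succ)]
        exact ih.append (h2 j)
    -- Only states that are entered by a transition are known to lie in `D`, hence the shift by one.
    have hsD : ∀ i, s (i + 1) ∈ D := by
      intro i
      obtain ⟨r, -, hr, hst, -⟩ := run_of_reach_slice (hp (Nat.lt_add_one i)).le (h2 i)
      have hlt := hp (Nat.lt_add_one i)
      have h4 := hstep _ _ _ (hst (pos (i + 1) - 1) (by omega) (by omega))
      rw [Nat.sub_add_cancel (by omega), hr] at h4
      exact h4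
    obtain ⟨q, -, hq⟩ : ∃ q ∈ D, ∃ᶠ i in atTop, s (i + 1) = q := by
      by_contra! h
      have h5 : ∀ᶠ i in atTop, ∀ q ∈ D, s (i + 1) ≠ q :=
        (Filter.eventually_all_finite hD).2 fun q hq => by simpa using h q hq
      obtain ⟨i, hi⟩ := h5.exists
      exact hi _ (hsD i) rfl
    rw [frequently_atTop] at hq h3
    -- An accepting block `k` is placed between two visits of `q`, at `i + 1` and `j + 1`. The slice
    -- between these visits has the type of `v` and gives the accepting loop.
    obtain ⟨i, -, hi⟩ := hq 0
    obtain ⟨k, hk, hacc⟩ := h3 (i + 1)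
    obtain ⟨j, hj, hj'⟩ := hq (k + 1)
    refine ⟨s 0, h1, q, ?_, ?_⟩
    · rw [← reach_congr (hu (i + 1) (by omega)), ← hi]
      simpa [h0] using hseg 0 (i + 1) (by omega)
    · rw [← reach_congr (hv (i + 1) (j + 1) (by omega) (by omega)),
        ← slice_append_slice z (hp.monotone hk) (hp.monotone (by omega : k ≤ j + 1)),
        ← slice_append_slice z (hp.monotone k.le_succ) (hp.monotone (by omega : k + 1 ≤ j + 1))]
      have h6 := (hseg (i + 1) k hk).append (hacc.append (hseg (k + 1) (j + 1) (by omega)))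
      simpa [hi, hj'] using h6
  · rintro ⟨p, hps, q, h1, h2⟩
    have h3 : ∀ i, 1 ≤ i → M.Reach true q (slice z (pos i) (pos (i + 1))) q := fun i hi =>
      (reach_congr (hv i (i + 1) hi i.lt_succ_self)).2 h2
    refine ⟨fun i => if i = 0 then p else q, by simpa using hps, ?_, ?_⟩
    · intro i
      rcases Nat.eq_zero_or_pos i with rfl | hi
      · simpa [h0] using (reach_congr (hu 1 le_rfl)).2 h1
      · simpa [hi.ne'] using (h3 i hi).false
    · rw [frequently_atTop]
      intro N
      exact ⟨N + 1, by omega, by simpa using h3 (N + 1) (by omega)⟩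

end NFA

end PathType

/-! ### Short representatives of congruence classes. -/

section Shortening

/-- If `f` is a left and right congruence with values in a finite set `S`, then every word is
equivalent to a word over the same letters of length at most `S.card`. -/
theorem exists_short_word {α T : Type*} (f : List α → T)
    (hf : ∀ u u' v v' : List α, f u = f u' → f v = f v' → f (u ++ v) = f (u' ++ v'))
    (S : Finset T) (hS : ∀ w, f w ∈ S) (w : List α) :
    ∃ w', w'.length ≤ S.card ∧ (∀ a ∈ w', a ∈ w) ∧ f w' = f w ∧ (w ≠ [] → w' ≠ []) := by
  induction hn : w.length using Nat.strong_induction_on generalizing w with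
  | _ n ih =>
    subst hn
    by_cases hlen : w.length ≤ S.card
    · exact ⟨w, hlen, fun a h => h, rfl, id⟩
    push Not at hlen
    -- Two prefixes in the same class allow the letters between them to be cut out. Only prefixes of
    -- positive length are counted, so the shortened word is nonempty.
    obtain ⟨i, hi, j, hj, hij, heq⟩ := Finset.exists_ne_map_eq_of_card_lt_of_maps_to
      (s := Finset.Icc 1 w.length) (t := S) (f := fun i => f (w.take i)) (by simpa using hlen)
      (fun i _ => hS _)
    simp only [Finset.mem_Icc] at hi hj
    wlog hlt : i < j generalizing i j with H
    · exact H j i hij.symm heq.symm hj hi (by omega)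
    obtain ⟨w', h1, h2, h3, h4⟩ := ih (w.take i ++ w.drop j).length (by simp; omega) _ rfl
    refine ⟨w', h1, fun a ha => ?_, ?_, fun _ => h4 ?_⟩
    · rcases List.mem_append.1 (h2 a ha) with h | h
      · exact List.mem_of_mem_take h
      · exact List.mem_of_mem_drop h
    · rw [h3, hf _ _ _ _ heq rfl, List.take_append_drop]
    · intro h
      have h5 := congrArg List.length h
      simp only [List.length_append, List.length_take, List.length_drop, List.length_nil] at h5
      omega

end Shortening

/-! ### Saturated solutions and the structure of maximal solutions. -/

section Saturation

variable {α : Type*}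

theorem substLetter_mono {X : Set α} {σ τ : X → Language α} (h : σ ≤ τ) {a : α} {u : List α}
    (hu : u ∈ substLetter σ a) : u ∈ substLetter τ a := by
  rcases hu with ⟨ha, hu⟩ | hu
  · exact .inl ⟨ha, h _ hu⟩
  · exact .inr hu

theorem substLang_mono {X : Set α} {σ τ : X → Language α} (h : σ ≤ τ) (L : Set (InfWord α)) :
    substLang σ L ⊆ substLang τ L := by
  rintro u ⟨w, hw, hu⟩
  refine ⟨w, hw, ?_⟩
  cases w with
  | fin w =>
    obtain ⟨v, hv, rfl⟩ := hu
    exact ⟨v, hv.imp fun _ _ => substLetter_mono h, rfl⟩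
  | inf w =>
    obtain ⟨v, hv, hu⟩ := hu
    exact ⟨v, fun i => substLetter_mono h (hv i), hu⟩

theorem substLetter_ne_nil {X : Set α} {σ : X → Language α} (h : ∀ x, ∀ u ∈ σ x, u ≠ [])
    {a : α} {u : List α} (hu : u ∈ substLetter σ a) : u ≠ [] := by
  rcases hu with ⟨ha, hu⟩ | ⟨_, rfl⟩
  · exact h _ u hu
  · simp

/-- Enlarging a solution within the equivalence classes of the automata for `R` (and within the
upper constraint) yields a solution. -/
theorem MatchingProblem.IsSolution.of_saturated {P : MatchingProblem α} (hP : P.WellFormed)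
    {rel : MatchRel} {Q₁ Q₂ : Type*} {M₁ : NFA α Q₁} {M₂ : NFA α Q₂} (hM₂ : M₂.accept.Finite)
    (hfin : ∀ w, InfWord.fin w ∈ P.R ↔ w ∈ M₁.accepts)
    (hinf : ∀ w, InfWord.inf w ∈ P.R ↔ w ∈ buchiLanguage M₂)
    {σ τ : P.X → Language α} (hσ : P.IsSolution rel σ) (hle : σ ≤ τ)
    (hτ : ∀ x, τ x ≤ P.upper x)
    (h : ∀ x, ∀ u ∈ τ x, ∃ u' ∈ σ x, M₁.pathType u = M₁.pathType u' ∧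
      M₂.pathType u = M₂.pathType u') : P.IsSolution rel τ := by
  have hτne : ∀ x, ∀ u ∈ τ x, u ≠ [] := fun x u hu => (hP.upper_over x u (hτ x hu)).1
  have hσne : ∀ x, ∀ u ∈ σ x, u ≠ [] := fun x u hu => hτne x u (hle x hu)
  have hex : ∀ a, ∀ u ∈ substLetter τ a, ∃ u' ∈ substLetter σ a,
      M₁.pathType u = M₁.pathType u' ∧ M₂.pathType u = M₂.pathType u' := by
    rintro a u (⟨ha, hu⟩ | ⟨ha, rfl⟩)
    · obtain ⟨u', hu', h'⟩ := h _ u hu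
      exact ⟨u', .inl ⟨ha, hu'⟩, h'⟩
    · exact ⟨[a], .inr ⟨ha, rfl⟩, rfl, rfl⟩
  have hσR : substLang σ P.L ⊆ P.R := by
    cases rel with
    | sub => exact hσ.1
    | eq => exact (show substLang σ P.L = P.R from hσ.1).le
  have hτR : substLang τ P.L ⊆ P.R := by
    rintro u ⟨w, hw, hu⟩
    cases w with
    | fin w =>
      obtain ⟨v, hv, rfl⟩ := hu
      obtain ⟨v', hv', hvv⟩ : ∃ v', List.Forall₂ (fun a s => s ∈ substLetter σ a) w v' ∧
          List.Forall₂ (fun s s' => M₁.pathType s = M₁.pathType s') v v' := by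
        clear hw
        induction hv with
        | nil => exact ⟨[], .nil, .nil⟩
        | cons h1 _ ih =>
          obtain ⟨v', h2, h3⟩ := ih
          obtain ⟨u', hu', h4, -⟩ := hex _ _ h1
          exact ⟨u' :: v', .cons hu' h2, .cons h4 h3⟩
      rw [hfin, NFA.mem_accepts_congr (NFA.pathType_flatten hvv), ← hfin]
      exact hσR ⟨_, hw, v', hv', rfl⟩
    | inf w =>
      obtain ⟨v, hv, hu⟩ := hu
      have hvne : ∀ i, v i ≠ [] := fun i => substLetter_ne_nil hτne (hv i)
      choose v' hv' h1 h2 using fun i => hex _ _ (hv i)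
      have hvne' : ∀ i, v' i ≠ [] := fun i => substLetter_ne_nil hσne (hv' i)
      cases u with
      | fin u => exact absurd hu (not_isConcat_fin hvne u)
      | inf z =>
        obtain ⟨z', hz'⟩ := exists_isConcat hvne'
        rw [hinf, NFA.mem_buchiLanguage_congr hM₂ hvne hvne' h2 hu hz', ← hinf]
        exact hσR ⟨_, hw, v', hv', hz'⟩
  refine ⟨?_, fun x => ⟨(hσ.2 x).1.trans (hle x), hτ x⟩⟩
  cases rel with
  | sub => exact hτR
  | eq =>
    have h1 : substLang σ P.L = P.R := hσ.1
    -- A larger substitution has a larger image, so covering `R` is inherited from `σ`.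
    exact subset_antisymm hτR (h1 ▸ substLang_mono hle P.L)

/-- An element maximal among the finitely many candidates satisfying `p` is maximal outright:
whatever lies above it and satisfies `p` lies below another such candidate. -/
theorem exists_maximal_of_finite {β : Type*} [PartialOrder β] {p : β → Prop} {C : Set β}
    (hC : C.Finite) (h : ∀ a, p a → ∃ c ∈ C, p c ∧ a ≤ c) :
    (∀ a, p a → ∃ m, Maximal p m ∧ a ≤ m) ∧ ∀ m, Maximal p m → m ∈ C := by
  have hmem : ∀ m, Maximal p m → m ∈ C := fun m hm => by
    obtain ⟨c, hc, hpc, hle⟩ := h m hm.1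
    exact (hm.eq_of_le hpc hle) ▸ hc
  refine ⟨fun a ha => ?_, hmem⟩
  obtain ⟨c, hc, hpc, hle⟩ := h a ha
  obtain ⟨m, hcm, hm⟩ := (hC.subset (Set.sep_subset C p)).exists_le_maximal
    (show c ∈ {c ∈ C | p c} from ⟨hc, hpc⟩)
  refine ⟨m, ⟨hm.1.2, fun b hb hmb => ?_⟩, hle.trans hcm⟩
  obtain ⟨c', hc', hpc', hle'⟩ := h b hb
  exact hle'.trans (hm.2 ⟨hc', hpc'⟩ (hmb.trans hle'))

/-- The left quotient by `u` depends only on `f u`, so there are finitely many quotients and the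
Myhill–Nerode criterion applies. -/
theorem isRegular_preimage_of_congruence {T : Type*} [Finite T] (f : List α → T)
    (hf : ∀ u u' v v' : List α, f u = f u' → f v = f v' → f (u ++ v) = f (u' ++ v'))
    (F : Set T) : Language.IsRegular ({u | f u ∈ F} : Language α) := by
  apply Language.IsRegular.of_finite_range_leftQuotient
  refine (Set.finite_range fun t : T =>
    ({v | ∃ u, f u = t ∧ f (u ++ v) ∈ F} : Language α)).subset ?_
  rintro _ ⟨u, rfl⟩
  refine ⟨f u, ?_⟩
  ext v
  constructor
  · rintro ⟨u', h, h'⟩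
    exact (show f (u ++ v) ∈ F from hf _ _ _ _ h rfl ▸ h')
  · intro h
    exact ⟨u, rfl, h⟩

/-- Solutions are bounded by finitely many maximal solutions, which are regular. -/
theorem MatchingProblem.maximal_solutions {P : MatchingProblem α} (hP : P.WellFormed)
    (hreg : P.Regular) (rel : MatchRel) :
    (∀ σ, P.IsSolution rel σ → ∃ τ, Maximal (P.IsSolution rel) τ ∧ σ ≤ τ) ∧
      {τ | Maximal (P.IsSolution rel) τ}.Finite ∧
      ∀ τ, Maximal (P.IsSolution rel) τ → ∀ x, (τ x).IsRegular := by
  obtain ⟨⟨Q₁, _, M₁, hM₁⟩, ⟨Q₂, _, M₂, hM₂⟩⟩ := hreg.R_reg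
  have hX : Finite P.X := hP.finite_X
  let f : List α → Set (Bool × Q₁ × Q₁) × Set (Bool × Q₂ × Q₂) := fun u =>
    (M₁.toNFA.pathType u, M₂.pathType u)
  have hf : ∀ u u' v v' : List α, f u = f u' → f v = f v' → f (u ++ v) = f (u' ++ v') := by
    intro u u' v v' h h'
    exact Prod.ext (NFA.pathType_append (congrArg Prod.fst h) (congrArg Prod.fst h'))
      (NFA.pathType_append (congrArg Prod.snd h) (congrArg Prod.snd h'))
  let cand : (P.X → Set (Set (Bool × Q₁ × Q₁) × Set (Bool × Q₂ × Q₂))) →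
      P.X → Language α := fun F x => P.upper x ⊓ {u | f u ∈ F x}
  have hbound : ∀ σ, P.IsSolution rel σ →
      ∃ τ ∈ Set.range cand, P.IsSolution rel τ ∧ σ ≤ τ := by
    intro σ hσ
    -- The candidate above `σ` admits at each variable exactly the types that occur in `σ x`.
    refine ⟨_, ⟨fun x => f '' σ x, rfl⟩, ?_⟩
    have hle : σ ≤ cand fun x => f '' σ x := fun x u hu =>
      ⟨(hσ.2 x).2 hu, Set.mem_image_of_mem f hu⟩
    refine ⟨hσ.of_saturated hP (M₁ := M₁.toNFA) (M₂ := M₂) (Set.toFinite _) ?_ ?_ hle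
      (fun x => inf_le_left) ?_, hle⟩
    · intro w
      rw [DFA.toNFA_correct, hM₁]
      rfl
    · intro w
      rw [hM₂]
      rfl
    · rintro x u ⟨-, u', hu', h⟩
      exact ⟨u', hu', congrArg Prod.fst h.symm, congrArg Prod.snd h.symm⟩
  obtain ⟨h1, h2⟩ := exists_maximal_of_finite (Set.finite_range cand) hbound
  refine ⟨h1, (Set.finite_range cand).subset h2, fun τ hτ x => ?_⟩
  obtain ⟨F, rfl⟩ := h2 τ hτ
  exact (hreg.upper_reg x).inf (isRegular_preimage_of_congruence f hf (F x))

end Saturation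

/-! ### Primitive recursive list operations, set up for `fun_prop`. -/

section PrimrecToolbox

attribute [fun_prop] Primrec
attribute [fun_prop] Primrec.id Primrec.const Primrec.comp Primrec.fst Primrec.snd Primrec.pair

namespace Primrec

variable {α β σ : Type*} [Primcodable α] [Primcodable β] [Primcodable σ]

@[fun_prop]
theorem fun_cons {f : α → β} {g : α → List β} (hf : Primrec f) (hg : Primrec g) :
    Primrec fun a => f a :: g a :=
  list_cons.comp hf hg

@[fun_prop]
theorem fun_append {f g : α → List β} (hf : Primrec f) (hg : Primrec g) :
    Primrec fun a => f a ++ g a :=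
  list_append.comp hf hg

@[fun_prop]
theorem fun_length {f : α → List β} (hf : Primrec f) : Primrec fun a => (f a).length :=
  list_length.comp hf

@[fun_prop]
theorem fun_encode {f : α → β} (hf : Primrec f) : Primrec fun a => Encodable.encode (f a) :=
  Primrec.encode.comp hf

@[fun_prop]
theorem fun_some {f : α → β} (hf : Primrec f) : Primrec fun a => some (f a) :=
  option_some.comp hf

@[fun_prop]
theorem fun_pow {f g : α → ℕ} (hf : Primrec f) (hg : Primrec g) : Primrec fun a => f a ^ g a :=
  (Primrec₂.unpaired'.1 Nat.Primrec.pow).comp hf hg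

@[fun_prop]
theorem fun_and {f g : α → Bool} (hf : Primrec f) (hg : Primrec g) :
    Primrec fun a => f a && g a :=
  Primrec.and.comp hf hg

@[fun_prop]
theorem fun_or {f g : α → Bool} (hf : Primrec f) (hg : Primrec g) :
    Primrec fun a => f a || g a :=
  Primrec.or.comp hf hg

@[fun_prop]
theorem fun_not {f : α → Bool} (hf : Primrec f) : Primrec fun a => !(f a) :=
  Primrec.not.comp hf

@[fun_prop]
theorem fun_decide_eq {f g : α → β} [∀ a, Decidable (f a = g a)] (hf : Primrec f)
    (hg : Primrec g) : Primrec fun a => decide (f a = g a) := by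
  classical
  refine (Primrec.eq.decide.comp hf hg).of_eq fun a => ?_
  simp

@[fun_prop]
theorem fun_cond {c : α → Bool} {f g : α → β} (hc : Primrec c) (hf : Primrec f)
    (hg : Primrec g) : Primrec fun a => bif c a then f a else g a :=
  Primrec.cond hc hf hg

@[fun_prop]
theorem fun_foldr {f : α → List β} {g : α → σ} {h : α → β → σ → σ} (hf : Primrec f)
    (hg : Primrec g) (hh : Primrec fun p : α × β × σ => h p.1 p.2.1 p.2.2) :
    Primrec fun a => (f a).foldr (h a) (g a) :=
  list_foldr (h := fun a p => h a p.1 p.2) hf hg hh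

@[fun_prop]
theorem fun_any {f : α → List β} {g : α → β → Bool} (hf : Primrec f)
    (hg : Primrec fun p : α × β => g p.1 p.2) : Primrec fun a => (f a).any (g a) := by
  have h : Primrec fun a => (f a).foldr (fun b s => g a b || s) false := by fun_prop
  refine h.of_eq fun a => ?_
  induction f a <;> simp_all

@[fun_prop]
theorem fun_all {f : α → List β} {g : α → β → Bool} (hf : Primrec f)
    (hg : Primrec fun p : α × β => g p.1 p.2) : Primrec fun a => (f a).all (g a) := by
  have h : Primrec fun a => (f a).foldr (fun b s => g a b && s) true := by fun_prop
  refine h.of_eq fun a => ?_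
  induction f a <;> simp_all

@[fun_prop]
theorem fun_decide_mem {f : α → β} {g : α → List β} [∀ a, Decidable (f a ∈ g a)]
    (hf : Primrec f) (hg : Primrec g) : Primrec fun a => decide (f a ∈ g a) := by
  classical
  have h : Primrec fun a => (g a).any fun b => decide (b = f a) := by fun_prop
  refine h.of_eq fun a => ?_
  rw [Bool.eq_iff_iff]
  simp

@[fun_prop]
theorem fun_map {f : α → List β} {g : α → β → σ} (hf : Primrec f)
    (hg : Primrec fun p : α × β => g p.1 p.2) : Primrec fun a => (f a).map (g a) :=
  list_map hf hg

@[fun_prop]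
theorem fun_flatMap {f : α → List β} {g : α → β → List σ} (hf : Primrec f)
    (hg : Primrec fun p : α × β => g p.1 p.2) : Primrec fun a => (f a).flatMap (g a) :=
  list_flatMap hf hg

@[fun_prop]
theorem fun_filter {f : α → List β} {g : α → β → Bool} (hf : Primrec f)
    (hg : Primrec fun p : α × β => g p.1 p.2) : Primrec fun a => (f a).filter (g a) := by
  have h : Primrec fun a => (f a).flatMap fun b => bif g a b then [b] else [] := by fun_prop
  refine h.of_eq fun a => ?_
  induction f a with
  | nil => rfl
  | cons b l ih => cases h : g a b <;> simp_all

end Primrec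

/-- The list with the single entry `x` if `c` holds, and the empty list otherwise. -/
def guardList {β : Type*} (c : Bool) (x : β) : List β := bif c then [x] else []

@[simp] theorem mem_guardList {β : Type*} {c : Bool} {x y : β} :
    y ∈ guardList c x ↔ c = true ∧ y = x := by
  cases c <;> simp [guardList]

@[fun_prop]
theorem Primrec.guardList {α β : Type*} [Primcodable α] [Primcodable β] {c : α → Bool}
    {x : α → β} (hc : Primrec c) (hx : Primrec x) : Primrec fun a => guardList (c a) (x a) := by
  unfold _root_.guardList
  fun_prop

/-- All words over `Γ` of length at most `n`. -/
def wordsUpTo {α : Type*} (Γ : List α) (n : ℕ) : List (List α) :=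
  n.rec [[]] fun _ W => [] :: Γ.flatMap fun a => W.map (a :: ·)

theorem mem_wordsUpTo {α : Type*} {Γ : List α} {n : ℕ} {w : List α} :
    w ∈ wordsUpTo Γ n ↔ w.length ≤ n ∧ ∀ a ∈ w, a ∈ Γ := by
  induction n generalizing w with
  | zero =>
    have h : w ∈ wordsUpTo Γ 0 ↔ w = [] := List.mem_singleton
    rw [h]
    constructor
    · rintro rfl; simp
    · intro h; simpa using h.1
  | succ n ih =>
    have h : w ∈ wordsUpTo Γ (n + 1) ↔
        w = [] ∨ ∃ a ∈ Γ, ∃ u ∈ wordsUpTo Γ n, a :: u = w := by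
      simp [wordsUpTo]
    rw [h]
    cases w with
    | nil => simp
    | cons a w => simp [ih]; tauto

@[fun_prop]
theorem Primrec.wordsUpTo {α β : Type*} [Primcodable α] [Primcodable β] {f : α → List β}
    {g : α → ℕ} (hf : Primrec f) (hg : Primrec g) :
    Primrec fun a => wordsUpTo (f a) (g a) := by
  refine Primrec.nat_rec' (f := g) (g := fun _ => [[]])
    (h := fun a p => [] :: (f a).flatMap fun b => p.2.map (b :: ·)) hg (by fun_prop) ?_
  change Primrec fun q : α × ℕ × List (List β) =>
    [] :: (f q.1).flatMap fun b => q.2.2.map (b :: ·)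
  fun_prop

end PrimrecToolbox

/-! ### The procedures on coded automata. -/

section Algorithms

variable {α : Type*} [DecidableEq α]

namespace AutCode

instance instDecidableEqTypeList : DecidableEq (List (AutCode α × Bool × ℕ × ℕ)) :=
  haveI : DecidableEq (AutCode α) := inferInstance
  inferInstance

/-- The states that occur in the automaton. -/
def states (A : AutCode α) : List ℕ :=
  A.1.map (fun t => t.1) ++ (A.1.map (fun t => t.2.2) ++ (A.2.1 ++ A.2.2))

/-- The letters that occur in the automaton. -/
def letters (A : AutCode α) : List α := A.1.map fun t => t.2.1

/-- The triples obtained by extending the triple `s` with the transition `t` labelled by `a`. -/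
def extendTriple (A : AutCode α) (a : α) (t : ℕ × α × ℕ) (s : Bool × ℕ × ℕ) :
    List (Bool × ℕ × ℕ) :=
  [false, true].flatMap fun b =>
    guardList (decide (t.2.1 = a) && (decide (s.2.1 = t.2.2) &&
      (!b || (s.1 || decide (t.1 ∈ A.2.2))))) (b, t.1, s.2.2)

/-- The triples `(b, p, q)` for which there is a path with first letter `a` from `p` to `q` whose
remaining part is described by the list `T`. -/
def extendTypes (A : AutCode α) (a : α) (T : List (Bool × ℕ × ℕ)) : List (Bool × ℕ × ℕ) :=
  A.1.flatMap fun t => T.flatMap fun s => A.extendTriple a t s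

/-- The list of all `(b, p, q)` for which there is a path from `p` to `q` labelled by the word,
visiting an accepting state if `b` is true. -/
def types (A : AutCode α) (w : List α) : List (Bool × ℕ × ℕ) :=
  w.foldr (fun a T => A.extendTypes a T)
    (A.states.flatMap fun p => (false, p, p) :: guardList (decide (p ∈ A.2.2)) (true, p, p))

def acceptsWord (A : AutCode α) (w : List α) : Bool :=
  A.2.1.any fun p => A.2.2.any fun q => decide ((false, p, q) ∈ A.types w)

/-- There is a path labelled by `u` from an initial state to a state `q`, and a path labelled by
`v` from `q` to `q` that visits an accepting state. -/
def lasso (A : AutCode α) (u v : List α) : Bool :=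
  A.2.1.any fun p => A.states.any fun q =>
    decide ((false, p, q) ∈ A.types u) && decide ((true, q, q) ∈ A.types v)

/-- All values that can occur in the types of words, for each of the automata. -/
def typeSpace (As : List (AutCode α)) : List (AutCode α × Bool × ℕ × ℕ) :=
  As.flatMap fun A => [false, true].flatMap fun b => A.states.flatMap fun p =>
    A.states.map fun q => (A, b, p, q)

/-- The types of a word with respect to all of the automata, in a canonical form. -/
def jointType (As : List (AutCode α)) (w : List α) : List (AutCode α × Bool × ℕ × ℕ) :=
  (typeSpace As).filter fun x => decide (x.2 ∈ x.1.types w)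

/-- A bound for the number of joint types. -/
def typeBound (As : List (AutCode α)) : ℕ := 2 ^ (typeSpace As).length

/-- Decides the inclusion of the union of the languages of finite words. -/
def inclFin (As Bs : List (AutCode α)) : Bool :=
  (wordsUpTo (As.flatMap letters) (typeBound (As ++ Bs))).all fun w =>
    !(As.any fun A => A.acceptsWord w) || Bs.any fun B => B.acceptsWord w

/-- Decides the inclusion of the languages of infinite words. -/
def inclBuchi (A B : AutCode α) : Bool :=
  (wordsUpTo A.letters (typeBound [A, B])).all fun u =>
    (wordsUpTo A.letters (typeBound [A, B])).all fun v =>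
      decide (u = []) || (decide (v = []) ||
        (!decide (jointType [A, B] (v ++ v) = jointType [A, B] v) ||
          (!decide (jointType [A, B] (u ++ v) = jointType [A, B] u) ||
            (!A.lasso u v || B.lasso u v))))

/-- An automaton for the nonempty words over `Sig` which have the same joint type as `w`. -/
def classAut [Encodable α] (As : List (AutCode α)) (Sig : List α) (w : List α) : AutCode α :=
  ((wordsUpTo Sig (typeBound As)).flatMap fun u => Sig.flatMap fun c =>
      (wordsUpTo Sig (typeBound As)).flatMap fun u' =>
        guardList (!decide (u' = []) && decide (jointType As u' = jointType As (u ++ [c])))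
          (Encodable.encode u, c, Encodable.encode u'),
    [Encodable.encode ([] : List α)],
    (wordsUpTo Sig (typeBound As)).flatMap fun u =>
      guardList (!decide (u = []) && decide (jointType As u = jointType As w))
        (Encodable.encode u))

end AutCode

namespace SubstCode

/-- The automata listed for a variable. -/
def auts (S : SubstCode α) (x : α) : List (AutCode α) :=
  S.flatMap fun e => guardList (decide (e.1 = x)) e.2

/-- The state of the substitution automaton at the boundary between two factors. -/
def outer (α : Type*) [Encodable α] (q : ℕ) : ℕ :=
  Encodable.encode ((q, none) : ℕ × Option (AutCode α × ℕ))

/-- The state of the substitution automaton which is inside of a factor read by the automaton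
`B` in state `s`, and which continues in the state `q` afterwards. -/
def inner [Encodable α] (q : ℕ) (B : AutCode α) (s : ℕ) : ℕ :=
  Encodable.encode ((q, some (B, s)) : ℕ × Option (AutCode α × ℕ))

/-- An automaton for the image of the language of `A` under the substitution `S`. -/
def substAut [Encodable α] (X : List α) (S : SubstCode α) (A : AutCode α) : AutCode α :=
  (A.1.flatMap fun t =>
      guardList (!decide (t.2.1 ∈ X)) (outer α t.1, t.2.1, outer α t.2.2) ++
      S.flatMap fun e => bif decide (t.2.1 ∈ X) && decide (e.1 = t.2.1) then
        e.2.1.flatMap fun r =>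
          -- Four kinds of moves: inside a factor, entering it, leaving it, and both at once for a
          -- factor of one letter. Empty factors are never produced, so no silent moves are needed.
          (inner t.2.2 e.2 r.1, r.2.1, inner t.2.2 e.2 r.2.2) ::
          (guardList (decide (r.1 ∈ e.2.2.1)) (outer α t.1, r.2.1, inner t.2.2 e.2 r.2.2) ++
          (guardList (decide (r.2.2 ∈ e.2.2.2)) (inner t.2.2 e.2 r.1, r.2.1, outer α t.2.2) ++
          guardList (decide (r.1 ∈ e.2.2.1) && decide (r.2.2 ∈ e.2.2.2))
            (outer α t.1, r.2.1, outer α t.2.2)))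
        else [],
    A.2.1.map (outer α), A.2.2.map (outer α))

/-- Decides the pointwise inclusion of substitutions. -/
def inclSubst (X : List α) (S S' : SubstCode α) : Bool :=
  X.all fun x => AutCode.inclFin (S.auts x) (S'.auts x)

end SubstCode

namespace ProblemCode

variable [Encodable α]

def isSubSolution (I : ProblemCode α) (S : SubstCode α) : Bool :=
  (SubstCode.inclSubst I.1.2 I.2.2.1 S && SubstCode.inclSubst I.1.2 S I.2.2.2) &&
    (AutCode.inclFin [S.substAut I.1.2 I.2.1.1.1] [I.2.1.2.1] &&
      AutCode.inclBuchi (S.substAut I.1.2 I.2.1.1.2) I.2.1.2.2)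

def isSolutionCode (rel : MatchRel) (I : ProblemCode α) (S : SubstCode α) : Bool :=
  match rel with
  | .sub => isSubSolution I S
  | .eq => isSubSolution I S &&
      (AutCode.inclFin [I.2.1.2.1] [S.substAut I.1.2 I.2.1.1.1] &&
        AutCode.inclBuchi I.2.1.2.2 (S.substAut I.1.2 I.2.1.1.2))

/-- The automata that are relevant for the saturation of solutions. -/
def relevantAuts (I : ProblemCode α) : List (AutCode α) :=
  -- The automata of the upper constraint are included so that saturation does not leave it.
  I.2.1.2.1 :: I.2.1.2.2 :: I.2.2.2.map fun e => e.2

/-- The pairs of a variable and a representative of a joint type. -/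
def classSpace (I : ProblemCode α) : List (α × List α) :=
  I.1.2.flatMap fun x => (wordsUpTo I.1.1 (AutCode.typeBound I.relevantAuts)).map fun w => (x, w)

/-- The substitution given by a list of variables and representatives of joint types. -/
def classSubst (I : ProblemCode α) (F : List (α × List α)) : SubstCode α :=
  F.map fun e => (e.1, AutCode.classAut I.relevantAuts I.1.1 e.2)

/-- Every solution is bounded by a solution on this list. -/
def candidates (I : ProblemCode α) : List (SubstCode α) :=
  -- Lists up to this length suffice to spell out every subset of `classSpace`.
  (wordsUpTo I.classSpace I.classSpace.length).map fun F => I.classSubst F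

def maximalSolutions (rel : MatchRel) (I : ProblemCode α) : List (SubstCode α) :=
  I.candidates.filter fun S => isSolutionCode rel I S &&
    I.candidates.all fun S' => !isSolutionCode rel I S' ||
      (!SubstCode.inclSubst I.1.2 S S' || SubstCode.inclSubst I.1.2 S' S)

def hasSolution (rel : MatchRel) (I : ProblemCode α) : Bool :=
  I.candidates.any fun S => isSolutionCode rel I S

end ProblemCode

end Algorithms

/-! ### Primitive recursiveness of the procedures. -/

section Computability

variable {α β : Type*} [Primcodable α] [Primcodable β] [DecidableEq α]

set_option linter.unusedSectionVars false

@[fun_prop]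
theorem AutCode.primrec_states {f : β → AutCode α} (hf : Primrec f) :
    Primrec fun a => (f a).states := by
  unfold states
  fun_prop

@[fun_prop]
theorem AutCode.primrec_letters {f : β → AutCode α} (hf : Primrec f) :
    Primrec fun a => (f a).letters := by
  unfold letters
  fun_prop

@[fun_prop]
theorem AutCode.primrec_extendTriple {f : β → AutCode α} {g : β → α} {h : β → ℕ × α × ℕ}
    {k : β → Bool × ℕ × ℕ} (hf : Primrec f) (hg : Primrec g) (hh : Primrec h) (hk : Primrec k) :
    Primrec fun a => (f a).extendTriple (g a) (h a) (k a) := by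
  unfold extendTriple
  fun_prop

@[fun_prop]
theorem AutCode.primrec_extendTypes {f : β → AutCode α} {g : β → α}
    {h : β → List (Bool × ℕ × ℕ)} (hf : Primrec f) (hg : Primrec g) (hh : Primrec h) :
    Primrec fun a => (f a).extendTypes (g a) (h a) := by
  unfold extendTypes
  fun_prop

@[fun_prop]
theorem AutCode.primrec_types {f : β → AutCode α} {g : β → List α} (hf : Primrec f)
    (hg : Primrec g) : Primrec fun a => (f a).types (g a) := by
  unfold types
  fun_prop

@[fun_prop]
theorem AutCode.primrec_acceptsWord {f : β → AutCode α} {g : β → List α} (hf : Primrec f)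
    (hg : Primrec g) : Primrec fun a => (f a).acceptsWord (g a) := by
  unfold acceptsWord
  fun_prop

@[fun_prop]
theorem AutCode.primrec_lasso {f : β → AutCode α} {g h : β → List α} (hf : Primrec f)
    (hg : Primrec g) (hh : Primrec h) : Primrec fun a => (f a).lasso (g a) (h a) := by
  unfold lasso
  fun_prop

@[fun_prop]
theorem AutCode.primrec_typeSpace {f : β → List (AutCode α)} (hf : Primrec f) :
    Primrec fun a => typeSpace (f a) := by
  unfold typeSpace
  fun_prop

@[fun_prop]
theorem AutCode.primrec_jointType {f : β → List (AutCode α)} {g : β → List α} (hf : Primrec f)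
    (hg : Primrec g) : Primrec fun a => jointType (f a) (g a) := by
  unfold jointType
  fun_prop

@[fun_prop]
theorem AutCode.primrec_typeBound {f : β → List (AutCode α)} (hf : Primrec f) :
    Primrec fun a => typeBound (f a) := by
  unfold typeBound
  fun_prop

@[fun_prop]
theorem AutCode.primrec_inclFin {f g : β → List (AutCode α)} (hf : Primrec f)
    (hg : Primrec g) : Primrec fun a => inclFin (f a) (g a) := by
  unfold inclFin
  fun_prop

@[fun_prop]
theorem AutCode.primrec_inclBuchi {f g : β → AutCode α} (hf : Primrec f)
    (hg : Primrec g) : Primrec fun a => inclBuchi (f a) (g a) := by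
  unfold inclBuchi
  fun_prop

@[fun_prop]
theorem AutCode.primrec_classAut {f : β → List (AutCode α)} {g h : β → List α} (hf : Primrec f)
    (hg : Primrec g) (hh : Primrec h) : Primrec fun a => classAut (f a) (g a) (h a) := by
  unfold classAut
  fun_prop

@[fun_prop]
theorem SubstCode.primrec_auts {f : β → SubstCode α} {g : β → α} (hf : Primrec f)
    (hg : Primrec g) : Primrec fun a => (f a).auts (g a) := by
  unfold auts
  fun_prop

@[fun_prop]
theorem SubstCode.primrec_outer {f : β → ℕ} (hf : Primrec f) :
    Primrec fun a => outer α (f a) := by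
  unfold outer
  fun_prop

@[fun_prop]
theorem SubstCode.primrec_inner {f h : β → ℕ} {g : β → AutCode α} (hf : Primrec f)
    (hg : Primrec g) (hh : Primrec h) : Primrec fun a => inner (f a) (g a) (h a) := by
  unfold inner
  fun_prop

@[fun_prop]
theorem SubstCode.primrec_substAut {f : β → List α} {g : β → SubstCode α} {h : β → AutCode α}
    (hf : Primrec f) (hg : Primrec g) (hh : Primrec h) :
    Primrec fun a => substAut (f a) (g a) (h a) := by
  unfold substAut
  fun_prop

@[fun_prop]
theorem SubstCode.primrec_inclSubst {f : β → List α} {g h : β → SubstCode α}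
    (hf : Primrec f) (hg : Primrec g) (hh : Primrec h) :
    Primrec fun a => inclSubst (f a) (g a) (h a) := by
  unfold inclSubst
  fun_prop

namespace ProblemCode

@[fun_prop]
theorem primrec_isSubSolution {f : β → ProblemCode α} {g : β → SubstCode α} (hf : Primrec f)
    (hg : Primrec g) : Primrec fun a => isSubSolution (f a) (g a) := by
  unfold isSubSolution
  fun_prop

@[fun_prop]
theorem primrec_isSolutionCode (rel : MatchRel) {f : β → ProblemCode α} {g : β → SubstCode α}
    (hf : Primrec f) (hg : Primrec g) : Primrec fun a => isSolutionCode rel (f a) (g a) := by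
  cases rel
  · exact primrec_isSubSolution hf hg
  · change Primrec fun a => isSubSolution (f a) (g a) && _
    fun_prop

@[fun_prop]
theorem primrec_relevantAuts {f : β → ProblemCode α} (hf : Primrec f) :
    Primrec fun a => relevantAuts (f a) := by
  unfold relevantAuts
  fun_prop

@[fun_prop]
theorem primrec_classSpace {f : β → ProblemCode α} (hf : Primrec f) :
    Primrec fun a => classSpace (f a) := by
  unfold classSpace
  fun_prop

@[fun_prop]
theorem primrec_classSubst {f : β → ProblemCode α} {g : β → List (α × List α)} (hf : Primrec f)
    (hg : Primrec g) : Primrec fun a => classSubst (f a) (g a) := by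
  unfold classSubst
  fun_prop

@[fun_prop]
theorem primrec_candidates {f : β → ProblemCode α} (hf : Primrec f) :
    Primrec fun a => candidates (f a) := by
  unfold candidates
  fun_prop

theorem primrec_maximalSolutions (rel : MatchRel) :
    Primrec (maximalSolutions rel : ProblemCode α → List (SubstCode α)) := by
  unfold maximalSolutions
  fun_prop

theorem primrec_hasSolution (rel : MatchRel) :
    Primrec (hasSolution rel : ProblemCode α → Bool) := by
  unfold hasSolution
  fun_prop

end ProblemCode

end Computability

/-! ### Tabulated types and correctness of the inclusion tests. -/

section Inclusion

variable {α : Type*}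

namespace AutCode

theorem mem_step {A : AutCode α} {p q : ℕ} {a : α} :
    q ∈ A.toNFA.step p a ↔ (p, a, q) ∈ A.1 := Iff.rfl

theorem mem_accept {A : AutCode α} {p : ℕ} : p ∈ A.toNFA.accept ↔ p ∈ A.2.2 := Iff.rfl

theorem finite_accept (A : AutCode α) : A.toNFA.accept.Finite := A.2.2.finite_toSet

theorem source_mem_states {A : AutCode α} {p q : ℕ} {a : α} (h : (p, a, q) ∈ A.1) :
    p ∈ A.states :=
  List.mem_append_left _ (List.mem_map.2 ⟨_, h, rfl⟩)

theorem target_mem_states {A : AutCode α} {p q : ℕ} {a : α} (h : (p, a, q) ∈ A.1) :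
    q ∈ A.states :=
  List.mem_append_right _ (List.mem_append_left _ (List.mem_map.2 ⟨_, h, rfl⟩))

theorem start_mem_states {A : AutCode α} {p : ℕ} (h : p ∈ A.2.1) : p ∈ A.states :=
  List.mem_append_right _ (List.mem_append_right _ (List.mem_append_left _ h))

theorem mem_states_of_reach {A : AutCode α} {b : Bool} {p q : ℕ} {w : List α}
    (hp : p ∈ A.states) (h : A.toNFA.Reach b p w q) : q ∈ A.states := by
  induction w generalizing b p with
  | nil => exact h.1 ▸ hp
  | cons a w ih =>
    obtain ⟨c, -, r, hr, h⟩ := h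
    exact ih (target_mem_states hr) h

theorem source_mem_states_of_reach {A : AutCode α} {b : Bool} {p q : ℕ} {w : List α}
    (hw : w ≠ []) (h : A.toNFA.Reach b p w q) : p ∈ A.states := by
  cases w with
  | nil => exact absurd rfl hw
  | cons a w =>
    obtain ⟨c, -, r, hr, -⟩ := h
    exact source_mem_states hr

theorem mem_letters_of_reach {A : AutCode α} {b : Bool} {p q : ℕ} {w : List α}
    (h : A.toNFA.Reach b p w q) : ∀ a ∈ w, a ∈ A.letters := by
  induction w generalizing b p with
  | nil => simp
  | cons a w ih =>
    obtain ⟨c, -, r, hr, h⟩ := h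
    intro d hd
    rcases List.mem_cons.1 hd with rfl | hd
    · exact List.mem_map.2 ⟨_, hr, rfl⟩
    · exact ih h d hd

theorem mem_typeSpace {As : List (AutCode α)} {x : AutCode α × Bool × ℕ × ℕ} :
    x ∈ typeSpace As ↔ x.1 ∈ As ∧ x.2.2.1 ∈ x.1.states ∧ x.2.2.2 ∈ x.1.states := by
  obtain ⟨A, b, p, q⟩ := x
  simp only [typeSpace, List.mem_flatMap, List.mem_map, Prod.mk.injEq]
  constructor
  · rintro ⟨A', hA, b', -, p', hp, q', hq, rfl, rfl, rfl, rfl⟩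
    exact ⟨hA, hp, hq⟩
  · rintro ⟨hA, hp, hq⟩
    exact ⟨A, hA, b, by cases b <;> simp, p, hp, q, hq, rfl, rfl, rfl, rfl⟩

variable [DecidableEq α]

theorem mem_extendTriple {A : AutCode α} {a : α} {t : ℕ × α × ℕ} {s x : Bool × ℕ × ℕ} :
    x ∈ A.extendTriple a t s ↔ t.2.1 = a ∧ s.2.1 = t.2.2 ∧
      (x.1 = true → s.1 = true ∨ t.1 ∈ A.2.2) ∧ x.2 = (t.1, s.2.2) := by
  obtain ⟨b, p, q⟩ := x
  cases b <;> simp [extendTriple, and_assoc]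

/-- The restriction to `states` matters because every natural number is a state of `A.toNFA`, and
the empty word joins each of them to itself. -/
theorem mem_types {A : AutCode α} {w : List α} {b : Bool} {p q : ℕ} :
    (b, p, q) ∈ A.types w ↔ p ∈ A.states ∧ A.toNFA.Reach b p w q := by
  induction w generalizing b p with
  | nil =>
    simp only [types, List.foldr_nil, List.mem_flatMap, List.mem_cons, mem_guardList,
      decide_eq_true_eq, NFA.Reach]
    constructor
    · rintro ⟨r, hr, h | ⟨h, h'⟩⟩
      · cases h
        exact ⟨hr, rfl, by simp⟩
      · cases h'
        exact ⟨hr, rfl, fun _ => h⟩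
    · rintro ⟨h, rfl, h'⟩
      refine ⟨p, h, ?_⟩
      cases b
      · exact .inl rfl
      · exact .inr ⟨h' rfl, rfl⟩
  | cons a w ih =>
    have h0 : A.types (a :: w) = A.extendTypes a (A.types w) := rfl
    simp only [h0, extendTypes, List.mem_flatMap, mem_extendTriple]
    constructor
    · rintro ⟨⟨p', a', r⟩, ht, ⟨c, r', q'⟩, hs, h1, h2, h3, h4⟩
      simp only [Prod.mk.injEq] at h1 h2 h3 h4
      obtain ⟨rfl, rfl⟩ := h4
      subst h1 h2
      exact ⟨source_mem_states ht, c, h3, r', ht, (ih.1 hs).2⟩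
    · rintro ⟨hp, c, hc, r, hr, h⟩
      exact ⟨(p, a, r), hr, (c, r, q), ih.2 ⟨target_mem_states hr, h⟩, rfl, rfl, hc, rfl⟩

theorem acceptsWord_iff {A : AutCode α} {w : List α} :
    A.acceptsWord w = true ↔ w ∈ A.toNFA.accepts := by
  simp only [acceptsWord, List.any_eq_true, decide_eq_true_eq, mem_types,
    NFA.mem_accepts_iff_reach]
  constructor
  · rintro ⟨p, hp, q, hq, -, h⟩
    exact ⟨p, hp, q, hq, h⟩
  · rintro ⟨p, hp, q, hq, h⟩
    exact ⟨p, hp, q, hq, start_mem_states hp, h⟩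

theorem lasso_iff {A : AutCode α} {u v : List α} :
    A.lasso u v = true ↔ ∃ p ∈ A.toNFA.start, ∃ q,
      A.toNFA.Reach false p u q ∧ A.toNFA.Reach true q v q := by
  simp only [lasso, List.any_eq_true, Bool.and_eq_true, decide_eq_true_eq, mem_types]
  constructor
  · rintro ⟨p, hp, q, hq, h1, h2⟩
    exact ⟨p, hp, q, h1.2, h2.2⟩
  · rintro ⟨p, hp, q, h1, h2⟩
    have h3 := start_mem_states hp
    have h4 := mem_states_of_reach h3 h1
    exact ⟨p, hp, q, h4, ⟨h3, h1⟩, h4, h2⟩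

/-- The table lists only occurring states, yet `q` may be any number: a path that begins in an
occurring state ends in one. -/
theorem jointType_eq_iff {As : List (AutCode α)} {u v : List α} :
    jointType As u = jointType As v ↔ ∀ A ∈ As, ∀ b, ∀ p ∈ A.states, ∀ q,
      A.toNFA.Reach b p u q ↔ A.toNFA.Reach b p v q := by
  constructor
  · intro h A hA b p hp q
    have h1 : ∀ w, q ∈ A.states →
        (A.toNFA.Reach b p w q ↔ (A, b, p, q) ∈ jointType As w) := by
      intro w hq
      simp [jointType, mem_typeSpace, mem_types, hA, hp, hq]
    by_cases hq : q ∈ A.states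
    · rw [h1 u hq, h1 v hq, h]
    · exact ⟨fun h => absurd (mem_states_of_reach hp h) hq,
        fun h => absurd (mem_states_of_reach hp h) hq⟩
  · intro h
    refine List.filter_congr fun x hx => ?_
    obtain ⟨A, b, p, q⟩ := x
    obtain ⟨hA, hp, -⟩ := mem_typeSpace.1 hx
    simp [mem_types, h A hA b p hp q]

theorem jointType_append {As : List (AutCode α)} {u u' v v' : List α}
    (h : jointType As u = jointType As u') (h' : jointType As v = jointType As v') :
    jointType As (u ++ v) = jointType As (u' ++ v') := by
  rw [jointType_eq_iff] at *
  intro A hA b p hp q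
  simp only [NFA.reach_append]
  constructor
  · rintro ⟨r, b₁, b₂, hb, h1, h2⟩
    have hr := mem_states_of_reach hp h1
    exact ⟨r, b₁, b₂, hb, (h A hA _ p hp r).1 h1, (h' A hA _ r hr q).1 h2⟩
  · rintro ⟨r, b₁, b₂, hb, h1, h2⟩
    have hr := mem_states_of_reach hp h1
    exact ⟨r, b₁, b₂, hb, (h A hA _ p hp r).2 h1, (h' A hA _ r hr q).2 h2⟩

/-- A path along a nonempty word begins at the source of a transition, so the table misses no pair
of states. The empty word also joins numbers outside the table. -/
theorem pathType_eq_of_jointType_eq {As : List (AutCode α)} {u v : List α} (hu : u ≠ [])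
    (hv : v ≠ []) (h : jointType As u = jointType As v) {A : AutCode α} (hA : A ∈ As) :
    A.toNFA.pathType u = A.toNFA.pathType v := by
  rw [jointType_eq_iff] at h
  ext ⟨b, p, q⟩
  change A.toNFA.Reach b p u q ↔ A.toNFA.Reach b p v q
  exact ⟨fun h' => (h A hA b p (source_mem_states_of_reach hu h') q).1 h',
    fun h' => (h A hA b p (source_mem_states_of_reach hv h') q).2 h'⟩

theorem mem_accepts_congr {As : List (AutCode α)} {u v : List α}
    (h : jointType As u = jointType As v) {A : AutCode α} (hA : A ∈ As) :
    u ∈ A.toNFA.accepts ↔ v ∈ A.toNFA.accepts := by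
  rw [jointType_eq_iff] at h
  simp only [NFA.mem_accepts_iff_reach]
  refine exists_congr fun p => and_congr_right fun hp => exists_congr fun q =>
    and_congr_right fun _ => h A hA false p (start_mem_states hp) q

theorem finite_range_jointType (As : List (AutCode α)) :
    (Set.range (jointType As)).Finite := by
  refine (List.finite_toSet (typeSpace As).sublists).subset ?_
  rintro _ ⟨w, rfl⟩
  exact List.mem_sublists.2 List.filter_sublist

/-- Joint types are sublists of `typeSpace As`, so `typeBound As` bounds their number and hence the
length of a shortest representative. -/
theorem exists_short (As : List (AutCode α)) (Γ : List α) (w : List α) (hw : ∀ a ∈ w, a ∈ Γ) :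
    ∃ w' ∈ wordsUpTo Γ (typeBound As), jointType As w' = jointType As w ∧
      (w ≠ [] → w' ≠ []) := by
  obtain ⟨w', h1, h2, h3, h4⟩ := exists_short_word (jointType As)
    (fun _ _ _ _ => jointType_append) (typeSpace As).sublists.toFinset
    (fun w => List.mem_toFinset.2 (List.mem_sublists.2 List.filter_sublist)) w
  refine ⟨w', mem_wordsUpTo.2 ⟨h1.trans ?_, fun a ha => hw a (h2 a ha)⟩, h3, h4⟩
  exact (List.toFinset_card_le _).trans (List.length_sublists _).le

/-- A counterexample can be replaced by a short word of the same joint type for `As ++ Bs`, since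
this type determines acceptance by all the automata. -/
theorem inclFin_iff {As Bs : List (AutCode α)} :
    inclFin As Bs = true ↔ ∀ w, (∃ A ∈ As, w ∈ A.toNFA.accepts) →
      ∃ B ∈ Bs, w ∈ B.toNFA.accepts := by
  have h0 : inclFin As Bs = true ↔ ∀ w ∈ wordsUpTo (As.flatMap letters) (typeBound (As ++ Bs)),
      (∃ A ∈ As, w ∈ A.toNFA.accepts) → ∃ B ∈ Bs, w ∈ B.toNFA.accepts := by
    simp only [inclFin, List.all_eq_true, Bool.or_eq_true, Bool.not_eq_true', List.any_eq_true,
      acceptsWord_iff, ← Bool.not_eq_true, imp_iff_not_or]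
  rw [h0]
  refine ⟨fun h w => ?_, fun h w _ => h w⟩
  rintro ⟨A, hA, hw⟩
  obtain ⟨p, -, q, -, hr⟩ := NFA.mem_accepts_iff_reach.1 hw
  obtain ⟨w', h1, h2, -⟩ := exists_short (As ++ Bs) (As.flatMap letters) w fun a ha =>
    List.mem_flatMap.2 ⟨A, hA, mem_letters_of_reach hr a ha⟩
  obtain ⟨B, hB, hB'⟩ := h w' h1
    ⟨A, hA, (mem_accepts_congr h2 (List.mem_append_left _ hA)).2 hw⟩
  exact ⟨B, hB, (mem_accepts_congr h2 (List.mem_append_right _ hB)).1 hB'⟩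

theorem mem_buchiLanguage_iff_lasso (A : AutCode α) {z : ℕ → α} {pos : ℕ → ℕ}
    (hp : StrictMono pos) (h0 : pos 0 = 0) {u v : List α}
    (hu : ∀ i, 1 ≤ i → A.toNFA.pathType (slice z 0 (pos i)) = A.toNFA.pathType u)
    (hv : ∀ i j, 1 ≤ i → i < j →
      A.toNFA.pathType (slice z (pos i) (pos j)) = A.toNFA.pathType v) :
    z ∈ buchiLanguage A.toNFA ↔ A.lasso u v = true := by
  rw [lasso_iff]
  exact NFA.mem_buchiLanguage_iff_lasso A.finite_accept (List.finite_toSet A.states)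
    (fun p a q h => target_mem_states h) hp h0 hu hv

/-- By Ramsey's theorem every infinite word factors, up to types, as `u v v v ...` with `v`
idempotent and absorbed by `u`, and `u`, `v` can be chosen short. Either automaton accepts it
exactly if it has a lasso along `u` and `v`. Conversely each pair `u`, `v` that is tested comes from
the actual word `u v v v ...`. -/
theorem inclBuchi_iff {A B : AutCode α} :
    inclBuchi A B = true ↔ buchiLanguage A.toNFA ⊆ buchiLanguage B.toNFA := by
  have h0 : inclBuchi A B = true ↔ ∀ u ∈ wordsUpTo A.letters (typeBound [A, B]),
      ∀ v ∈ wordsUpTo A.letters (typeBound [A, B]), u ≠ [] → v ≠ [] →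
      jointType [A, B] (v ++ v) = jointType [A, B] v →
      jointType [A, B] (u ++ v) = jointType [A, B] u → A.lasso u v = true →
      B.lasso u v = true := by
    simp only [inclBuchi, List.all_eq_true, Bool.or_eq_true, Bool.not_eq_true',
      decide_eq_true_eq, ← Bool.not_eq_true, imp_iff_not_or,
      ne_eq, not_not]
  rw [h0]
  have hA : A ∈ [A, B] := by simp
  have hB : B ∈ [A, B] := by simp
  constructor
  · intro h z hz
    obtain ⟨n, e, hn, he⟩ := exists_monochromatic_subsequence
      (fun i j => jointType [A, B] (slice z i j)) (finite_range_jointType [A, B])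
      fun i j => ⟨_, rfl⟩
    -- Replacing `n 0` by `0` makes the prefixes homogeneous as well: each prefix up to `n i`, `i ≥
    -- 1`, is the prefix up to `n 0` followed by a slice of type `e`. This is why `u` absorbs `v`.
    let pos : ℕ → ℕ := fun i => if i = 0 then 0 else n i
    have hpos : ∀ i, 1 ≤ i → pos i = n i := fun i hi => by
      simp only [pos, if_neg (by omega : ¬ i = 0)]
    have hmono : StrictMono pos := strictMono_nat_of_lt_succ fun i => by
      rcases Nat.eq_zero_or_pos i with rfl | hi
      · have := hn.id_le 1
        rw [hpos 1 le_rfl]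
        exact this
      · rw [hpos i hi, hpos (i + 1) (by omega)]
        exact hn (Nat.lt_add_one i)
    have hlt0 : ∀ i, 1 ≤ i → 0 < pos i := fun i hi => hmono (by omega : 0 < i)
    have hv : ∀ i j, 1 ≤ i → i < j → jointType [A, B] (slice z (pos i) (pos j)) = e := by
      intro i j hi hij
      rw [hpos i hi, hpos j (by omega)]
      exact he i j hij
    have hle : ∀ i, n 0 ≤ n i := fun i => hn.monotone (Nat.zero_le i)
    have hu : ∀ i, 1 ≤ i → jointType [A, B] (slice z 0 (pos i)) =
        jointType [A, B] (slice z 0 (pos 1)) := by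
      intro i hi
      rw [hpos i hi, hpos 1 le_rfl, ← slice_append_slice z (Nat.zero_le (n 0)) (hle i),
        ← slice_append_slice z (Nat.zero_le (n 0)) (hle 1)]
      exact jointType_append rfl ((he 0 i (by omega)).trans (he 0 1 (by omega)).symm)
    have hletters : ∀ i j, ∀ a ∈ slice z i j, a ∈ A.letters := by
      intro i j a ha
      obtain ⟨k, -, -, rfl⟩ := mem_slice.1 ha
      obtain ⟨r, -, hr, -⟩ := hz
      exact List.mem_map.2 ⟨_, hr k, rfl⟩
    have hne1 : slice z 0 (pos 1) ≠ [] := slice_ne_nil z (hlt0 1 le_rfl)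
    have hne2 : slice z (pos 1) (pos 2) ≠ [] := slice_ne_nil z (hmono (by omega))
    obtain ⟨u, hu1, hu2, hu3⟩ := exists_short [A, B] A.letters _ (hletters 0 (pos 1))
    obtain ⟨v, hv1, hv2, hv3⟩ := exists_short [A, B] A.letters _ (hletters (pos 1) (pos 2))
    have hlasso : ∀ C ∈ [A, B], z ∈ buchiLanguage C.toNFA ↔ C.lasso u v = true := by
      intro C hC
      refine mem_buchiLanguage_iff_lasso C hmono rfl ?_ ?_
      · intro i hi
        exact pathType_eq_of_jointType_eq (slice_ne_nil z (hlt0 i hi)) (hu3 hne1)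
          ((hu i hi).trans hu2.symm) hC
      · intro i j hi hij
        exact pathType_eq_of_jointType_eq (slice_ne_nil z (hmono hij)) (hv3 hne2)
          ((hv i j hi hij).trans ((hv 1 2 le_rfl (by omega)).symm.trans hv2.symm)) hC
    have hm12 : pos 1 ≤ pos 2 := (hmono (by omega)).le
    have hm23 : pos 2 ≤ pos 3 := (hmono (by omega)).le
    refine (hlasso B hB).2 (h u hu1 v hv1 (hu3 hne1) (hv3 hne2) ?_ ?_ ((hlasso A hA).1 hz))
    -- Idempotence: two adjacent slices and their concatenation all have the type of `v`.
    · have h23 : jointType [A, B] v = jointType [A, B] (slice z (pos 2) (pos 3)) :=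
        hv2.trans ((hv 1 2 le_rfl (by omega)).trans (hv 2 3 (by omega) (by omega)).symm)
      rw [jointType_append hv2 h23, slice_append_slice z hm12 hm23, hv2,
        hv 1 3 le_rfl (by omega), hv 1 2 le_rfl (by omega)]
    · rw [jointType_append hu2 hv2, slice_append_slice z (Nat.zero_le _) hm12, hu2,
        hu 2 (by omega)]
  · intro h u _ v _ hu hv hvv huv hlas
    let blocks : ℕ → List α := fun i => if i = 0 then u else v
    have hne : ∀ i, blocks i ≠ [] := fun i => by
      by_cases hi : i = 0 <;> simp [blocks, hi, hu, hv]
    obtain ⟨z, hz⟩ := exists_isConcat hne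
    have hmono := concatPos_strictMono hne
    have hb : ∀ k, 1 ≤ k → blocks k = v := fun k hk => if_neg (by omega)
    have hcu : ∀ i, 1 ≤ i →
        jointType [A, B] (slice z 0 (concatPos blocks i)) = jointType [A, B] u := by
      intro i hi
      induction i, hi using Nat.le_induction with
      | base =>
        have := slice_concatPos hz 0
        rw [concatPos_zero] at this
        rw [this]
        rfl
      | succ i hi ih =>
        rw [← slice_append_slice z (Nat.zero_le _) (hmono.monotone i.le_succ),
          slice_concatPos hz i, ← huv]
        rw [hb i hi]
        exact jointType_append ih rfl
    have hcv : ∀ i j, 1 ≤ i → i < j →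
        jointType [A, B] (slice z (concatPos blocks i) (concatPos blocks j)) =
          jointType [A, B] v := by
      intro i j hi hij
      induction j, hij using Nat.le_induction with
      | base => rw [Nat.succ_eq_add_one, slice_concatPos hz i, hb i hi]
      | succ j hij ih =>
        rw [← slice_append_slice z (hmono.monotone (by omega : i ≤ j))
          (hmono.monotone j.le_succ), slice_concatPos hz j, hb j (by omega), ← hvv]
        exact jointType_append ih rfl
    have hlasso : ∀ C ∈ [A, B], z ∈ buchiLanguage C.toNFA ↔ C.lasso u v = true := by
      intro C hC
      refine mem_buchiLanguage_iff_lasso C hmono rfl ?_ ?_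
      · intro i hi
        have := hmono (by omega : 0 < i)
        exact pathType_eq_of_jointType_eq (slice_ne_nil z this) hu (hcu i hi) hC
      · intro i j hi hij
        exact pathType_eq_of_jointType_eq (slice_ne_nil z (hmono hij)) hv (hcv i j hi hij) hC
    exact (hlasso B hB).1 (h ((hlasso A hA).2 hlas))

end AutCode

end Inclusion

/-! ### Automata for type classes and for images under substitutions. -/

section Constructions

variable {α : Type*}

namespace SubstCode

theorem mem_auts [DecidableEq α] {S : SubstCode α} {x : α} {A : AutCode α} : A ∈ S.auts x ↔ (x, A) ∈ S := by
  simp only [auts, List.mem_flatMap, mem_guardList, decide_eq_true_eq]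
  constructor
  · rintro ⟨⟨y, B⟩, h, rfl, rfl⟩
    exact h
  · intro h
    exact ⟨_, h, rfl, rfl⟩

theorem mem_toSubst [DecidableEq α] {S : SubstCode α} {X : Set α} {x : X} {w : List α} :
    w ∈ S.toSubst X x ↔ ∃ A ∈ S.auts x.1, w ∈ A.toNFA.accepts := by
  simp only [mem_auts]
  rfl

theorem inclSubst_iff [DecidableEq α] {X : List α} {S S' : SubstCode α} :
    inclSubst X S S' = true ↔ S.toSubst {a | a ∈ X} ≤ S'.toSubst {a | a ∈ X} := by
  simp only [inclSubst, List.all_eq_true, AutCode.inclFin_iff]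
  constructor
  · intro h x w hw
    exact mem_toSubst.2 (h x.1 x.2 w (mem_toSubst.1 hw))
  · intro h x hx w hw
    exact mem_toSubst.1 (h ⟨x, hx⟩ (mem_toSubst.2 hw))

variable [Encodable α]

theorem outer_inj {q q' : ℕ} : outer α q = outer α q' ↔ q = q' := by
  simp [outer]

theorem inner_inj {q q' s s' : ℕ} {B B' : AutCode α} :
    inner q B s = inner q' B' s' ↔ q = q' ∧ B = B' ∧ s = s' := by
  simp [inner]

theorem outer_ne_inner {q q' s : ℕ} {B : AutCode α} : outer α q ≠ inner q' B s := by
  simp [outer, inner]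

end SubstCode

variable [DecidableEq α] [Encodable α]

namespace AutCode

theorem mem_classAut_step {As : List (AutCode α)} {Sig w : List α} {x y : ℕ} {c : α} :
    y ∈ (classAut As Sig w).toNFA.step x c ↔
      ∃ u ∈ wordsUpTo Sig (typeBound As), c ∈ Sig ∧ ∃ u' ∈ wordsUpTo Sig (typeBound As),
        u' ≠ [] ∧ jointType As u' = jointType As (u ++ [c]) ∧
          x = Encodable.encode u ∧ y = Encodable.encode u' := by
  rw [mem_step]
  simp only [classAut, List.mem_flatMap, mem_guardList, Bool.and_eq_true, Bool.not_eq_true',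
    decide_eq_false_iff_not, decide_eq_true_eq, Prod.mk.injEq]
  constructor
  · rintro ⟨u, hu, d, hd, u', hu', ⟨h1, h2⟩, h3, rfl, h4⟩
    exact ⟨u, hu, hd, u', hu', h1, h2, h3, h4⟩
  · rintro ⟨u, hu, hd, u', hu', h1, h2, h3, h4⟩
    exact ⟨u, hu, c, hd, u', hu', ⟨h1, h2⟩, h3, rfl, h4⟩

/-- States code short words and track the type of the input. No transition enters the initial state
`[]`, which keeps the empty word apart from nonempty words of the same type. -/
theorem reach_classAut {As : List (AutCode α)} {Sig w z : List α} {q : ℕ} :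
    (classAut As Sig w).toNFA.Reach false (Encodable.encode ([] : List α)) z q ↔
      (∀ a ∈ z, a ∈ Sig) ∧ ∃ u ∈ wordsUpTo Sig (typeBound As), q = Encodable.encode u ∧
        (z = [] ↔ u = []) ∧ jointType As u = jointType As z := by
  induction z using List.reverseRecOn generalizing q with
  | nil =>
    rw [NFA.reach_false_nil]
    constructor
    · rintro rfl
      exact ⟨by simp, [], mem_wordsUpTo.2 (by simp), rfl, Iff.rfl, rfl⟩
    · rintro ⟨-, u, -, rfl, h, -⟩
      rw [h.1 rfl]
  | append_singleton z c ih =>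
    rw [NFA.reach_false_append]
    simp only [ih, NFA.reach_false_cons, NFA.reach_false_nil, exists_eq_right,
      mem_classAut_step]
    constructor
    · rintro ⟨r, ⟨hz, u, hu, rfl, h1, h2⟩, u₁, hu₁, hc, u', hu', h3, h4, h5, rfl⟩
      rw [← Encodable.encode_injective h5] at h4
      refine ⟨?_, u', hu', rfl, by simp [h3], h4.trans (jointType_append h2 rfl)⟩
      intro a ha
      rcases List.mem_append.1 ha with ha | ha
      · exact hz a ha
      · rwa [List.mem_singleton.1 ha]
    · rintro ⟨hz, u', hu', rfl, h1, h2⟩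
      have hz' : ∀ a ∈ z, a ∈ Sig := fun a ha => hz a (List.mem_append_left _ ha)
      obtain ⟨u, hu, h3, h4⟩ : ∃ u ∈ wordsUpTo Sig (typeBound As),
          (z = [] ↔ u = []) ∧ jointType As u = jointType As z := by
        by_cases hnil : z = []
        · exact ⟨[], mem_wordsUpTo.2 (by simp), by simp [hnil], by rw [hnil]⟩
        · obtain ⟨u, h1, h2, h3⟩ := exists_short As Sig z hz'
          exact ⟨u, h1, by simp [hnil, h3 hnil], h2⟩
      refine ⟨_, ⟨hz', u, hu, rfl, h3, h4⟩, u, hu, hz c (by simp), u', hu', ?_, ?_, rfl, rfl⟩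
      · intro h
        simpa using h1.2 h
      · exact h2.trans (jointType_append h4.symm rfl)

theorem mem_accepts_classAut {As : List (AutCode α)} {Sig w z : List α} :
    z ∈ (classAut As Sig w).toNFA.accepts ↔
      z ≠ [] ∧ (∀ a ∈ z, a ∈ Sig) ∧ jointType As z = jointType As w := by
  have hstart : ∀ p, p ∈ (classAut As Sig w).toNFA.start ↔
      p = Encodable.encode ([] : List α) := fun p => List.mem_singleton
  have haccept : ∀ q, q ∈ (classAut As Sig w).toNFA.accept ↔
      ∃ u ∈ wordsUpTo Sig (typeBound As),
        (u ≠ [] ∧ jointType As u = jointType As w) ∧ q = Encodable.encode u := by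
    intro q
    rw [mem_accept]
    simp [classAut]
  simp only [NFA.mem_accepts_iff_reach, hstart, haccept, exists_eq_left, reach_classAut]
  constructor
  · rintro ⟨q, ⟨u, hu, ⟨h1, h2⟩, rfl⟩, hz, u', hu', h3, h4, h5⟩
    rw [← Encodable.encode_injective h3] at h4 h5
    exact ⟨fun h => h1 (h4.1 h), hz, h5.symm.trans h2⟩
  · rintro ⟨h1, hz, h2⟩
    obtain ⟨u, hu, h3, h4⟩ := exists_short As Sig z hz
    exact ⟨_, ⟨u, hu, ⟨h4 h1, h3.trans h2⟩, rfl⟩, hz, u, hu, rfl, by simp [h1, h4 h1], h3⟩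

end AutCode

namespace SubstCode

variable {X : List α} {S : SubstCode α} {A : AutCode α}

theorem mem_substAut_step {x y : ℕ} {c : α} :
    y ∈ (substAut X S A).toNFA.step x c ↔
      (∃ q q', (q, c, q') ∈ A.1 ∧ c ∉ X ∧ x = outer α q ∧ y = outer α q') ∨
      ∃ q a q' B s s', (q, a, q') ∈ A.1 ∧ a ∈ X ∧ (a, B) ∈ S ∧ (s, c, s') ∈ B.1 ∧
        ((x = inner q' B s ∧ y = inner q' B s') ∨
          (s ∈ B.2.1 ∧ x = outer α q ∧ y = inner q' B s') ∨
          (s' ∈ B.2.2 ∧ x = inner q' B s ∧ y = outer α q') ∨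
          ((s ∈ B.2.1 ∧ s' ∈ B.2.2) ∧ x = outer α q ∧ y = outer α q')) := by
  rw [AutCode.mem_step]
  simp only [substAut, List.mem_flatMap, List.mem_append, mem_guardList, Bool.not_eq_true',
    decide_eq_false_iff_not, Prod.mk.injEq]
  have hb : ∀ (b : Bool) (l : List (ℕ × α × ℕ)) t,
      t ∈ (bif b then l else []) ↔ b = true ∧ t ∈ l := by
    intro b l t
    cases b <;> simp
  simp only [hb, List.mem_flatMap, List.mem_cons, List.mem_append, mem_guardList, Prod.mk.injEq,
    Bool.and_eq_true, decide_eq_true_eq]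
  constructor
  · rintro ⟨⟨q, a, q'⟩, ht, ⟨h1, rfl, rfl, rfl⟩ |
      ⟨⟨a', B⟩, he, ⟨ha, rfl⟩, ⟨s, c', s'⟩, hr, h⟩⟩
    · exact .inl ⟨q, q', ht, h1, rfl, rfl⟩
    · rcases h with ⟨rfl, rfl, rfl⟩ | ⟨h, rfl, rfl, rfl⟩ | ⟨h, rfl, rfl, rfl⟩ | ⟨h, rfl, rfl, rfl⟩
      all_goals exact .inr ⟨q, _, q', B, s, s', ht, ha, he, hr, by tauto⟩
  · rintro (⟨q, q', ht, h1, rfl, rfl⟩ | ⟨q, a, q', B, s, s', ht, ha, he, hr, h⟩)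
    · exact ⟨_, ht, .inl ⟨h1, rfl, rfl, rfl⟩⟩
    · refine ⟨_, ht, .inr ⟨_, he, ⟨ha, rfl⟩, _, hr, ?_⟩⟩
      tauto

/-- The word `u` can be substituted for the letter of some transition from `q` to `q'`. -/
def Factor (X : List α) (S : SubstCode α) (A : AutCode α) (q : ℕ) (u : List α) (q' : ℕ) : Prop :=
  ∃ a, (q, a, q') ∈ A.1 ∧ u ∈ substLetter (S.toSubst {a | a ∈ X}) a

theorem reach_inner {q q' s s' : ℕ} {a : α} {B : AutCode α} (ht : (q, a, q') ∈ A.1)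
    (ha : a ∈ X) (he : (a, B) ∈ S) {u : List α} (hu : u ≠ [])
    (h : B.toNFA.Reach false s u s') (hs' : s' ∈ B.2.2) :
    (substAut X S A).toNFA.Reach false (inner q' B s) u (outer α q') := by
  induction u generalizing s with
  | nil => exact absurd rfl hu
  | cons c u ih =>
    obtain ⟨r, hr, h⟩ := NFA.reach_false_cons.1 h
    rw [NFA.reach_false_cons]
    by_cases hnil : u = []
    · subst hnil
      rw [NFA.reach_false_nil] at h
      subst h
      exact ⟨outer α q', mem_substAut_step.2 (.inr ⟨q, a, q', B, s, r, ht, ha, he, hr,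
        .inr (.inr (.inl ⟨hs', rfl, rfl⟩))⟩), NFA.reach_false_nil.2 rfl⟩
    · exact ⟨inner q' B r, mem_substAut_step.2 (.inr ⟨q, a, q', B, s, r, ht, ha, he, hr,
        .inl ⟨rfl, rfl⟩⟩), ih hnil h⟩

theorem reach_of_factor {q q' : ℕ} {u : List α} (hu : u ≠ []) (h : Factor X S A q u q') :
    (substAut X S A).toNFA.Reach false (outer α q) u (outer α q') := by
  obtain ⟨a, ht, ⟨ha, B, he, hB⟩ | ⟨ha, rfl⟩⟩ := h
  · obtain ⟨s, hs, s', hs', h⟩ := NFA.mem_accepts_iff_reach.1 hB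
    cases u with
    | nil => exact absurd rfl hu
    | cons c u =>
      obtain ⟨r, hr, h⟩ := NFA.reach_false_cons.1 h
      rw [NFA.reach_false_cons]
      by_cases hnil : u = []
      · subst hnil
        rw [NFA.reach_false_nil] at h
        subst h
        exact ⟨outer α q', mem_substAut_step.2 (.inr ⟨q, a, q', B, s, r, ht, ha, he, hr,
          .inr (.inr (.inr ⟨⟨hs, hs'⟩, rfl, rfl⟩))⟩), NFA.reach_false_nil.2 rfl⟩
      · exact ⟨inner q' B r, mem_substAut_step.2 (.inr ⟨q, a, q', B, s, r, ht, ha, he, hr,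
          .inr (.inl ⟨hs, rfl, rfl⟩)⟩), reach_inner ht ha he hnil h hs'⟩
  · rw [NFA.reach_false_cons]
    exact ⟨outer α q', mem_substAut_step.2 (.inl ⟨q, q', ht, ha, rfl, rfl⟩),
      NFA.reach_false_nil.2 rfl⟩

theorem reach_of_forall₂ (hne : ∀ x, ∀ u ∈ S.toSubst {a | a ∈ X} x, u ≠ []) {w : List α}
    {v : List (List α)}
    (hv : List.Forall₂ (fun a s => s ∈ substLetter (S.toSubst {a | a ∈ X}) a) w v) {p q : ℕ}
    (h : A.toNFA.Reach false p w q) :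
    (substAut X S A).toNFA.Reach false (outer α p) v.flatten (outer α q) := by
  induction hv generalizing p with
  | nil =>
    rw [NFA.reach_false_nil] at h
    exact h ▸ NFA.reach_false_nil.2 rfl
  | cons hs _ ih =>
    obtain ⟨r, hr, h⟩ := NFA.reach_false_cons.1 h
    rw [List.flatten_cons, NFA.reach_false_append]
    exact ⟨_, reach_of_factor (substLetter_ne_nil hne hs) ⟨_, hr, hs⟩, ih h⟩

/-- The path is cut at its outer states. The induction needs the second clause because removing the
first letter may leave a path that begins inside a factor; such a path completes a run of `B` before
it meets an outer state. -/
theorem exists_factorization_of_reach {u : List α} {x qf : ℕ}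
    (h : (substAut X S A).toNFA.Reach false x u (outer α qf)) :
    (∀ q, x = outer α q → ∃ w v, A.toNFA.Reach false q w qf ∧
      List.Forall₂ (fun a s => s ∈ substLetter (S.toSubst {a | a ∈ X}) a) w v ∧
        u = v.flatten) ∧
    ∀ q B s, x = inner q B s → ∃ u₁ s', s' ∈ B.2.2 ∧ B.toNFA.Reach false s u₁ s' ∧
      ∃ w v, A.toNFA.Reach false q w qf ∧
        List.Forall₂ (fun a s => s ∈ substLetter (S.toSubst {a | a ∈ X}) a) w v ∧
          u = u₁ ++ v.flatten := by
  induction u generalizing x with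
  | nil =>
    rw [NFA.reach_false_nil] at h
    subst h
    refine ⟨fun q hq => ⟨[], [], ?_, .nil, rfl⟩, fun q B s hx => absurd hx outer_ne_inner⟩
    rw [NFA.reach_false_nil, outer_inj.1 hq]
  | cons c u ih =>
    obtain ⟨y, hy, h⟩ := NFA.reach_false_cons.1 h
    obtain ⟨ih1, ih2⟩ := ih h
    rcases mem_substAut_step.1 hy with ⟨q₁, q₂, ht, hc, rfl, rfl⟩ |
      ⟨q₁, a, q₂, B₁, s₁, s₂, ht, ha, he, hr, h'⟩
    · refine ⟨fun q hq => ?_, fun q B s hx => absurd hx outer_ne_inner⟩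
      rw [outer_inj] at hq
      subst hq
      obtain ⟨w, v, h1, h2, rfl⟩ := ih1 q₂ rfl
      exact ⟨c :: w, [c] :: v, NFA.reach_false_cons.2 ⟨q₂, ht, h1⟩,
        .cons (.inr ⟨hc, rfl⟩) h2, rfl⟩
    · have hletter : ∀ u₁ s, s₁ ∈ B₁.2.1 → s ∈ B₁.2.2 → B₁.toNFA.Reach false s₂ u₁ s →
          c :: u₁ ∈ substLetter (S.toSubst {a | a ∈ X}) a := fun u₁ s h1 h2 h3 =>
        .inl ⟨ha, B₁, he, NFA.mem_accepts_iff_reach.2 ⟨s₁, h1, s, h2,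
          NFA.reach_false_cons.2 ⟨s₂, hr, h3⟩⟩⟩
      rcases h' with ⟨rfl, rfl⟩ | ⟨hs, rfl, rfl⟩ | ⟨hs, rfl, rfl⟩ | ⟨⟨hs, hs'⟩, rfl, rfl⟩
      · refine ⟨fun q hq => absurd hq.symm outer_ne_inner, fun q B s hx => ?_⟩
        obtain ⟨rfl, rfl, rfl⟩ := inner_inj.1 hx
        obtain ⟨u₁, s', h1, h2, w, v, h3, h4, rfl⟩ := ih2 _ _ _ rfl
        exact ⟨c :: u₁, s', h1, NFA.reach_false_cons.2 ⟨s₂, hr, h2⟩, w, v, h3, h4, rfl⟩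
      · refine ⟨fun q hq => ?_, fun q B s hx => absurd hx outer_ne_inner⟩
        rw [outer_inj] at hq
        subst hq
        obtain ⟨u₁, s', h1, h2, w, v, h3, h4, rfl⟩ := ih2 _ _ _ rfl
        exact ⟨a :: w, (c :: u₁) :: v, NFA.reach_false_cons.2 ⟨q₂, ht, h3⟩,
          .cons (hletter u₁ s' hs h1 h2) h4, rfl⟩
      · refine ⟨fun q hq => absurd hq.symm outer_ne_inner, fun q B s hx => ?_⟩
        obtain ⟨rfl, rfl, rfl⟩ := inner_inj.1 hx
        obtain ⟨w, v, h3, h4, rfl⟩ := ih1 _ rfl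
        exact ⟨[c], s₂, hs, NFA.reach_false_cons.2 ⟨s₂, hr, NFA.reach_false_nil.2 rfl⟩,
          w, v, h3, h4, rfl⟩
      · refine ⟨fun q hq => ?_, fun q B s hx => absurd hx outer_ne_inner⟩
        rw [outer_inj] at hq
        subst hq
        obtain ⟨w, v, h3, h4, rfl⟩ := ih1 _ rfl
        exact ⟨a :: w, [c] :: v, NFA.reach_false_cons.2 ⟨q₂, ht, h3⟩,
          .cons (hletter [] s₂ hs hs' (NFA.reach_false_nil.2 rfl)) h4, rfl⟩

theorem mem_substAut_start {x : ℕ} :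
    x ∈ (substAut X S A).toNFA.start ↔ ∃ p ∈ A.2.1, outer α p = x :=
  List.mem_map

theorem mem_substAut_accept {x : ℕ} :
    x ∈ (substAut X S A).toNFA.accept ↔ ∃ p ∈ A.2.2, outer α p = x :=
  List.mem_map

theorem mem_accepts_substAut (hne : ∀ x, ∀ u ∈ S.toSubst {a | a ∈ X} x, u ≠ []) {u : List α} :
    u ∈ (substAut X S A).toNFA.accepts ↔
      ∃ w ∈ A.toNFA.accepts, InfWord.fin u ∈ substWord (S.toSubst {a | a ∈ X}) (.fin w) := by
  simp only [NFA.mem_accepts_iff_reach]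
  constructor
  · rintro ⟨x, hx, y, hy, h⟩
    obtain ⟨p, hp, rfl⟩ := mem_substAut_start.1 hx
    obtain ⟨q, hq, rfl⟩ := mem_substAut_accept.1 hy
    obtain ⟨w, v, h1, h2, rfl⟩ := (exists_factorization_of_reach h).1 p rfl
    exact ⟨w, ⟨p, hp, q, hq, h1⟩, v, h2, rfl⟩
  · rintro ⟨w, ⟨p, hp, q, hq, h⟩, v, hv, hu⟩
    cases hu
    exact ⟨_, mem_substAut_start.2 ⟨p, hp, rfl⟩, _, mem_substAut_accept.2 ⟨q, hq, rfl⟩,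
      reach_of_forall₂ hne hv h⟩

theorem inner_run {r : ℕ → ℕ} {z : ℕ → α} {m n : ℕ} (hmn : m < n)
    (hr : ∀ k, m ≤ k → k < n → r (k + 1) ∈ (substAut X S A).toNFA.step (r k) (z k))
    {q q' s : ℕ} {B : AutCode α} (hm : r m = inner q B s) (hn : r n = outer α q')
    (hin : ∀ k, m < k → k < n → ∀ p, r k ≠ outer α p) :
    q = q' ∧ ∃ s' ∈ B.2.2, B.toNFA.Reach false s (slice z m n) s' := by
  obtain ⟨d, rfl⟩ := Nat.exists_eq_add_of_lt hmn
  induction d generalizing m s with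
  | zero =>
    have h := hr m le_rfl hmn
    rw [hm, show m + 1 = m + 0 + 1 from rfl, hn, mem_substAut_step] at h
    rw [slice_eq_cons z hmn, slice_self]
    rcases h with ⟨q₁, q₂, -, -, h, -⟩ | ⟨q₁, a, q₂, B₁, s₁, s₂, -, -, -, hB, h⟩
    · exact absurd h.symm outer_ne_inner
    · rcases h with ⟨-, h⟩ | ⟨-, h, -⟩ | ⟨hs, h1, h2⟩ | ⟨-, h, -⟩
      · exact absurd h outer_ne_inner
      · exact absurd h.symm outer_ne_inner
      · obtain ⟨rfl, rfl, rfl⟩ := inner_inj.1 h1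
        exact ⟨(outer_inj.1 h2).symm, s₂, hs, NFA.reach_false_cons.2
          ⟨s₂, hB, NFA.reach_false_nil.2 rfl⟩⟩
      · exact absurd h.symm outer_ne_inner
  | succ d ih =>
    have h := hr m le_rfl hmn
    rw [hm, mem_substAut_step] at h
    have hno := hin (m + 1) (by omega) (by omega)
    rcases h with ⟨q₁, q₂, -, -, h, -⟩ | ⟨q₁, a, q₂, B₁, s₁, s₂, -, -, -, hB, h⟩
    · exact absurd h.symm outer_ne_inner
    · rcases h with ⟨h1, h2⟩ | ⟨-, h, -⟩ | ⟨-, -, h⟩ | ⟨-, h, -⟩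
      · obtain ⟨rfl, rfl, rfl⟩ := inner_inj.1 h1
        have he : m + 1 + d + 1 = m + (d + 1) + 1 := by omega
        obtain ⟨h3, s', h4, h5⟩ := ih (m := m + 1) h2 (by omega)
          (fun k h h' => hr k (by omega) (by omega)) (by rw [he]; exact hn)
          (fun k h h' => hin k (by omega) (by omega))
        rw [he] at h5
        refine ⟨h3, s', h4, ?_⟩
        rw [slice_eq_cons z hmn]
        exact NFA.reach_false_cons.2 ⟨s₂, hB, h5⟩
      · exact absurd h.symm outer_ne_inner
      · exact absurd h (hno _)
      · exact absurd h.symm outer_ne_inner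

theorem factor_of_run {r : ℕ → ℕ} {z : ℕ → α} {m n : ℕ} (hmn : m < n)
    (hr : ∀ k, m ≤ k → k < n → r (k + 1) ∈ (substAut X S A).toNFA.step (r k) (z k))
    {q q' : ℕ} (hm : r m = outer α q) (hn : r n = outer α q')
    (hin : ∀ k, m < k → k < n → ∀ p, r k ≠ outer α p) : Factor X S A q (slice z m n) q' := by
  have h := hr m le_rfl hmn
  rw [hm, mem_substAut_step] at h
  have hlast : ∀ p, r (m + 1) = outer α p → n = m + 1 := by
    intro p hp
    by_contra hne
    exact hin (m + 1) (by omega) (by omega) p hp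
  rw [slice_eq_cons z hmn]
  rcases h with ⟨q₁, q₂, ht, hc, h1, h2⟩ | ⟨q₁, a, q₂, B, s₁, s₂, ht, ha, he, hB, h⟩
  · obtain rfl := hlast _ h2
    rw [hn] at h2
    obtain rfl := outer_inj.1 h1
    obtain rfl := outer_inj.1 h2
    rw [slice_self]
    exact ⟨_, ht, .inr ⟨hc, rfl⟩⟩
  · rcases h with ⟨h, -⟩ | ⟨hs, h1, h2⟩ | ⟨-, h, -⟩ | ⟨⟨hs, hs'⟩, h1, h2⟩
    · exact absurd h outer_ne_inner
    · obtain rfl := outer_inj.1 h1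
      have hlt : m + 1 < n := by
        rcases (Nat.succ_le_of_lt hmn).eq_or_lt with h | h
        · rw [← h] at hn
          exact absurd (hn.symm.trans h2) outer_ne_inner
        · exact h
      obtain ⟨rfl, s', hs', h3⟩ := inner_run hlt (fun k h h' => hr k (by omega) h') h2 hn
        (fun k h h' => hin k (by omega) h')
      exact ⟨a, ht, .inl ⟨ha, B, he, NFA.mem_accepts_iff_reach.2 ⟨s₁, hs, s', hs',
        NFA.reach_false_cons.2 ⟨s₂, hB, h3⟩⟩⟩⟩
    · exact absurd h outer_ne_inner
    · obtain rfl := hlast _ h2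
      rw [hn] at h2
      obtain rfl := outer_inj.1 h1
      obtain rfl := outer_inj.1 h2
      rw [slice_self]
      exact ⟨a, ht, .inl ⟨ha, B, he, NFA.mem_accepts_iff_reach.2 ⟨s₁, hs, s₂, hs',
        NFA.reach_false_cons.2 ⟨s₂, hB, NFA.reach_false_nil.2 rfl⟩⟩⟩⟩

theorem mem_buchiLanguage_substAut (hne : ∀ x, ∀ u ∈ S.toSubst {a | a ∈ X} x, u ≠ [])
    {z : ℕ → α} :
    z ∈ buchiLanguage (substAut X S A).toNFA ↔ ∃ w ∈ buchiLanguage A.toNFA,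
      InfWord.inf z ∈ substWord (S.toSubst {a | a ∈ X}) (.inf w) := by
  constructor
  · intro hz
    obtain ⟨r, h0, hr, hacc⟩ := (NFA.mem_buchiLanguage_iff (AutCode.finite_accept _)).1 hz
    classical
    -- These are the boundaries between factors. All accepting states are outer, so an accepting run
    -- has infinitely many boundaries, and `Nat.nth p` enumerates them with no outer state strictly
    -- between consecutive ones.
    let p : ℕ → Prop := fun n => ∃ q, r n = outer α q
    have hpacc : ∀ n, r n ∈ (substAut X S A).toNFA.accept → p n := fun n hn => by
      obtain ⟨q, -, hq⟩ := mem_substAut_accept.1 hn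
      exact ⟨q, hq.symm⟩
    have hinf : {n | p n}.Infinite := Nat.frequently_atTop_iff_infinite.1 (hacc.mono hpacc)
    have hp0 : p 0 := by
      obtain ⟨q, -, hq⟩ := mem_substAut_start.1 h0
      exact ⟨q, hq.symm⟩
    have hmono : StrictMono (Nat.nth p) := Nat.nth_strictMono hinf
    have hpos0 : Nat.nth p 0 = 0 := by simpa using Nat.nth_count hp0
    choose s hs using fun i => Nat.nth_mem_of_infinite hinf i
    have hbetween : ∀ i k, Nat.nth p i < k → k < Nat.nth p (i + 1) → ∀ q, r k ≠ outer α q := by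
      intro i k h1 h2 q hq
      have h3 : Nat.nth p (Nat.count p k) = k := Nat.nth_count ⟨q, hq⟩
      rw [← h3] at h1 h2
      have h4 := hmono.lt_iff_lt.1 h1
      have h5 := hmono.lt_iff_lt.1 h2
      omega
    choose a ha hu using fun i => factor_of_run (hmono (Nat.lt_add_one i))
      (fun k _ _ => hr k) (hs i) (hs (i + 1)) (hbetween i)
    refine ⟨a, (NFA.mem_buchiLanguage_iff (AutCode.finite_accept _)).2 ⟨s, ?_, ha, ?_⟩,
      _, hu, isConcat_of_slices hmono hpos0 fun i => rfl⟩
    · obtain ⟨q, hq, hq'⟩ := mem_substAut_start.1 h0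
      have h1 := hs 0
      rw [hpos0, ← hq', outer_inj] at h1
      exact h1 ▸ hq
    · rw [frequently_atTop] at hacc ⊢
      intro N
      obtain ⟨n, hn, hn'⟩ := hacc (Nat.nth p N)
      have h3 : Nat.nth p (Nat.count p n) = n := Nat.nth_count (hpacc n hn')
      refine ⟨Nat.count p n, hmono.le_iff_le.1 (by rw [h3]; exact hn), ?_⟩
      obtain ⟨q, hq, hq'⟩ := mem_substAut_accept.1 hn'
      have h1 := hs (Nat.count p n)
      rw [h3, ← hq', outer_inj] at h1
      exact h1 ▸ hq
  · rintro ⟨w, hw, v, hv, hz⟩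
    obtain ⟨r, h0, hr, hacc⟩ := (NFA.mem_buchiLanguage_iff A.finite_accept).1 hw
    have hvne : ∀ i, v i ≠ [] := fun i => substLetter_ne_nil hne (hv i)
    rw [NFA.mem_buchiLanguage_iff_blocks (AutCode.finite_accept _) (concatPos_strictMono hvne)
      (concatPos_zero v)]
    have hreach : ∀ i, (substAut X S A).toNFA.Reach false (outer α (r i)) (v i)
        (outer α (r (i + 1))) := fun i => reach_of_factor (hvne i) ⟨w i, hr i, hv i⟩
    simp only [slice_concatPos hz]
    exact ⟨fun i => outer α (r i), mem_substAut_start.2 ⟨_, h0, rfl⟩, hreach,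
      hacc.mono fun i hi => NFA.reach_true_of_start (mem_substAut_accept.2 ⟨_, hi, rfl⟩)
        (hreach i)⟩

end SubstCode

end Constructions

/-! ### Correctness of the algorithms. -/

section Effectiveness

variable {α : Type*} [DecidableEq α] [Encodable α]

namespace SubstCode

variable {X : List α} {S : SubstCode α} {C : InfLangCode α}

theorem fin_mem_substLang (hne : ∀ x, ∀ u ∈ S.toSubst {a | a ∈ X} x, u ≠ []) {u : List α} :
    InfWord.fin u ∈ substLang (S.toSubst {a | a ∈ X}) C.lang ↔
      u ∈ (substAut X S C.1).toNFA.accepts := by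
  rw [mem_accepts_substAut hne]
  constructor
  · rintro ⟨w, hw, hu⟩
    cases w with
    | fin w => exact ⟨w, hw, hu⟩
    | inf w =>
      obtain ⟨v, hv, hu⟩ := hu
      exact absurd hu (not_isConcat_fin (fun i => substLetter_ne_nil hne (hv i)) u)
  · rintro ⟨w, hw, hu⟩
    exact ⟨.fin w, hw, hu⟩

theorem inf_mem_substLang (hne : ∀ x, ∀ u ∈ S.toSubst {a | a ∈ X} x, u ≠ []) {z : ℕ → α} :
    InfWord.inf z ∈ substLang (S.toSubst {a | a ∈ X}) C.lang ↔
      z ∈ buchiLanguage (substAut X S C.2).toNFA := by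
  rw [mem_buchiLanguage_substAut hne]
  constructor
  · rintro ⟨w, hw, hu⟩
    cases w with
    | fin w =>
      obtain ⟨v, -, hu⟩ := hu
      cases hu
    | inf w => exact ⟨w, hw, hu⟩
  · rintro ⟨w, hw, hu⟩
    exact ⟨.inf w, hw, hu⟩

theorem substLang_subset_iff (hne : ∀ x, ∀ u ∈ S.toSubst {a | a ∈ X} x, u ≠ [])
    {R : InfLangCode α} :
    substLang (S.toSubst {a | a ∈ X}) C.lang ⊆ R.lang ↔
      (AutCode.inclFin [substAut X S C.1] [R.1] &&
        AutCode.inclBuchi (substAut X S C.2) R.2) = true := by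
  simp only [Bool.and_eq_true, AutCode.inclFin_iff, AutCode.inclBuchi_iff, List.mem_singleton,
    exists_eq_left, ← fin_mem_substLang hne]
  constructor
  · exact fun h => ⟨fun w hw => h hw, fun z hz => h ((inf_mem_substLang hne).2 hz)⟩
  · rintro ⟨h1, h2⟩ (w | z) hu
    · exact h1 w hu
    · exact h2 ((inf_mem_substLang hne).1 hu)

theorem subset_substLang_iff (hne : ∀ x, ∀ u ∈ S.toSubst {a | a ∈ X} x, u ≠ [])
    {R : InfLangCode α} :
    R.lang ⊆ substLang (S.toSubst {a | a ∈ X}) C.lang ↔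
      (AutCode.inclFin [R.1] [substAut X S C.1] &&
        AutCode.inclBuchi R.2 (substAut X S C.2)) = true := by
  simp only [Bool.and_eq_true, AutCode.inclFin_iff, AutCode.inclBuchi_iff, List.mem_singleton,
    exists_eq_left, ← fin_mem_substLang hne]
  constructor
  · exact fun h => ⟨fun w hw => h hw, fun z hz => (inf_mem_substLang hne).1 (h hz)⟩
  · rintro ⟨h1, h2⟩ (w | z) hu
    · exact h1 w hu
    · exact (inf_mem_substLang hne).2 (h2 hu)

end SubstCode

namespace ProblemCode

variable {I : ProblemCode α}

/-- The substitution automaton is only known to be correct for images without the empty word. The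
upper constraint ensures this, so the language tests are compared under the assumption that the
constraints hold. -/
theorem isSubSolution_iff (hI : I.toProblem.WellFormed) {S : SubstCode α} :
    isSubSolution I S = true ↔ I.toProblem.IsSolution .sub (S.toSubst I.toProblem.X) := by
  have h1 : ∀ S S' : SubstCode α, SubstCode.inclSubst I.1.2 S S' = true ↔
      S.toSubst I.toProblem.X ≤ S'.toSubst I.toProblem.X := fun _ _ => SubstCode.inclSubst_iff
  rw [isSubSolution, Bool.and_eq_true, Bool.and_eq_true, h1, h1, and_comm]
  have h2 : I.toProblem.IsSolution .sub (S.toSubst I.toProblem.X) ↔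
      (substLang (S.toSubst I.toProblem.X) I.toProblem.L ⊆ I.toProblem.R) ∧
      (I.toProblem.lower ≤ S.toSubst I.toProblem.X ∧
        S.toSubst I.toProblem.X ≤ I.toProblem.upper) := by
    refine and_congr_right fun _ => ?_
    exact ⟨fun h => ⟨fun x => (h x).1, fun x => (h x).2⟩, fun h x => ⟨h.1 x, h.2 x⟩⟩
  rw [h2]
  refine and_congr_left fun h => ?_
  have hne : ∀ x, ∀ u ∈ S.toSubst I.toProblem.X x, u ≠ [] := fun x u hu =>
    (hI.upper_over x u (h.2 x hu)).1
  exact (SubstCode.substLang_subset_iff hne).symm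

theorem isSolutionCode_iff (hI : I.toProblem.WellFormed) {rel : MatchRel} {S : SubstCode α} :
    isSolutionCode rel I S = true ↔
      I.toProblem.IsSolution rel (S.toSubst I.toProblem.X) := by
  cases rel with
  | sub => exact isSubSolution_iff hI
  | eq =>
    have h1 : isSolutionCode .eq I S = (isSubSolution I S &&
      (AutCode.inclFin [I.2.1.2.1] [S.substAut I.1.2 I.2.1.1.1] &&
        AutCode.inclBuchi I.2.1.2.2 (S.substAut I.1.2 I.2.1.1.2))) := rfl
    rw [h1, Bool.and_eq_true, isSubSolution_iff hI]
    have hne : I.toProblem.IsSolution .sub (S.toSubst I.toProblem.X) →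
        ∀ x, ∀ u ∈ S.toSubst I.toProblem.X x, u ≠ [] := fun h x u hu =>
      (hI.upper_over x u ((h.2 x).2 hu)).1
    constructor
    · rintro ⟨h, h'⟩
      exact ⟨subset_antisymm h.1 ((SubstCode.subset_substLang_iff (hne h)).2 h'), h.2⟩
    · intro h
      have heq : substLang (S.toSubst I.toProblem.X) I.toProblem.L = I.toProblem.R := h.1
      have hsub : I.toProblem.IsSolution .sub (S.toSubst I.toProblem.X) := ⟨heq.le, h.2⟩
      exact ⟨hsub, (SubstCode.subset_substLang_iff (hne hsub)).1 heq.ge⟩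

theorem mem_classSubst {F : List (α × List α)} {x : I.toProblem.X} {u : List α} :
    u ∈ (I.classSubst F).toSubst I.toProblem.X x ↔ ∃ w, (x.1, w) ∈ F ∧ u ≠ [] ∧
      (∀ a ∈ u, a ∈ I.1.1) ∧ AutCode.jointType I.relevantAuts u =
        AutCode.jointType I.relevantAuts w := by
  constructor
  · rintro ⟨A, hA, hu⟩
    obtain ⟨⟨y, w⟩, hw, h⟩ := List.mem_map.1 hA
    obtain ⟨h1, rfl⟩ := Prod.mk.inj h
    exact ⟨w, h1 ▸ hw, AutCode.mem_accepts_classAut.1 hu⟩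
  · rintro ⟨w, hw, hu⟩
    exact ⟨_, List.mem_map.2 ⟨_, hw, rfl⟩, AutCode.mem_accepts_classAut.2 hu⟩

/-- The candidate saturates `σ`: `F` collects the short words whose joint type occurs in `σ x`. The
automata for `R` among `relevantAuts` preserve the matching relation, and those of the upper
constraint preserve that bound. -/
theorem exists_candidate (hI : I.toProblem.WellFormed) {rel : MatchRel}
    {σ : I.toProblem.X → Language α} (hσ : I.toProblem.IsSolution rel σ) :
    ∃ S ∈ I.candidates, I.toProblem.IsSolution rel (S.toSubst I.toProblem.X) ∧
      σ ≤ S.toSubst I.toProblem.X := by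
  classical
  let F : List (α × List α) := I.classSpace.filter fun e =>
    decide (∃ h : e.1 ∈ I.toProblem.X, ∃ v ∈ σ ⟨e.1, h⟩,
      AutCode.jointType I.relevantAuts e.2 = AutCode.jointType I.relevantAuts v)
  have hF : ∀ x w, (x, w) ∈ F ↔ (x, w) ∈ I.classSpace ∧
      ∃ h : x ∈ I.toProblem.X, ∃ v ∈ σ ⟨x, h⟩,
        AutCode.jointType I.relevantAuts w = AutCode.jointType I.relevantAuts v := by
    intro x w
    simp only [F, List.mem_filter, decide_eq_true_eq]
  have hcand : I.classSubst F ∈ I.candidates := List.mem_map.2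
    ⟨F, mem_wordsUpTo.2 ⟨List.length_filter_le _ _, fun e he => (List.mem_filter.1 he).1⟩, rfl⟩
  have hle : σ ≤ (I.classSubst F).toSubst I.toProblem.X := by
    intro x u hu
    obtain ⟨hnil, hSig⟩ := hI.upper_over x u ((hσ.2 x).2 hu)
    obtain ⟨w, hw, hwu, -⟩ := AutCode.exists_short I.relevantAuts I.1.1 u hSig
    refine mem_classSubst.2 ⟨w, (hF _ _).2 ⟨?_, x.2, u, hu, hwu⟩, hnil, hSig, hwu.symm⟩
    exact List.mem_flatMap.2 ⟨x.1, x.2, List.mem_map.2 ⟨w, hw, rfl⟩⟩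
  have hclass : ∀ x, ∀ u ∈ (I.classSubst F).toSubst I.toProblem.X x, u ≠ [] ∧ ∃ v ∈ σ x,
      AutCode.jointType I.relevantAuts u = AutCode.jointType I.relevantAuts v := by
    intro x u hu
    obtain ⟨w, hw, hnil, -, huw⟩ := mem_classSubst.1 hu
    obtain ⟨v, hv, hwv⟩ := ((hF _ _).1 hw).2.2
    exact ⟨hnil, v, hv, huw.trans hwv⟩
  refine ⟨_, hcand, hσ.of_saturated hI (M₁ := I.2.1.2.1.toNFA) (M₂ := I.2.1.2.2.toNFA)
    (AutCode.finite_accept _) (fun w => Iff.rfl) (fun w => Iff.rfl) hle ?_ ?_, hle⟩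
  · intro x u hu
    obtain ⟨-, v, hv, huv⟩ := hclass x u hu
    obtain ⟨A, hA, hvA⟩ := (hσ.2 x).2 hv
    refine ⟨A, hA, (AutCode.mem_accepts_congr huv ?_).2 hvA⟩
    exact List.mem_cons_of_mem _ (List.mem_cons_of_mem _ (List.mem_map.2 ⟨_, hA, rfl⟩))
  · intro x u hu
    obtain ⟨hnil, v, hv, huv⟩ := hclass x u hu
    have hnil' : v ≠ [] := (hI.upper_over x v ((hσ.2 x).2 hv)).1
    exact ⟨v, hv, AutCode.pathType_eq_of_jointType_eq hnil hnil' huv (by simp [relevantAuts]),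
      AutCode.pathType_eq_of_jointType_eq hnil hnil' huv (by simp [relevantAuts])⟩

theorem hasSolution_iff (hI : I.toProblem.WellFormed) {rel : MatchRel} :
    hasSolution rel I = true ↔ ∃ σ, I.toProblem.IsSolution rel σ := by
  simp only [hasSolution, List.any_eq_true, isSolutionCode_iff hI]
  constructor
  · rintro ⟨S, -, hS⟩
    exact ⟨_, hS⟩
  · rintro ⟨σ, hσ⟩
    obtain ⟨S, hS, hS', -⟩ := exists_candidate hI hσ
    exact ⟨S, hS, hS'⟩

/-- Since every solution lies below a candidate that is a solution, maximal solutions are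
candidates, and comparison with candidates alone decides maximality. -/
theorem maximal_iff_mem_maximalSolutions (hI : I.toProblem.WellFormed) {rel : MatchRel}
    {τ : I.toProblem.X → Language α} :
    Maximal (I.toProblem.IsSolution rel) τ ↔
      ∃ S ∈ maximalSolutions rel I, τ = S.toSubst I.toProblem.X := by
  have hincl : ∀ S S' : SubstCode α, SubstCode.inclSubst I.1.2 S S' = true ↔
      S.toSubst I.toProblem.X ≤ S'.toSubst I.toProblem.X := fun _ _ => SubstCode.inclSubst_iff
  have hmem : ∀ S, S ∈ maximalSolutions rel I ↔ S ∈ I.candidates ∧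
      I.toProblem.IsSolution rel (S.toSubst I.toProblem.X) ∧ ∀ S' ∈ I.candidates,
        I.toProblem.IsSolution rel (S'.toSubst I.toProblem.X) →
        S.toSubst I.toProblem.X ≤ S'.toSubst I.toProblem.X →
        S'.toSubst I.toProblem.X ≤ S.toSubst I.toProblem.X := by
    intro S
    simp only [maximalSolutions, List.mem_filter, Bool.and_eq_true, List.all_eq_true,
      Bool.or_eq_true, Bool.not_eq_true', ← Bool.not_eq_true, isSolutionCode_iff hI, hincl,
      imp_iff_not_or]
  constructor
  · intro hτ
    obtain ⟨S, hS, hS', hle⟩ := exists_candidate hI hτ.1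
    obtain rfl := hτ.eq_of_le hS' hle
    exact ⟨S, (hmem S).2 ⟨hS, hS', fun S' _ h h' => hτ.2 h h'⟩, rfl⟩
  · rintro ⟨S, hS, rfl⟩
    obtain ⟨-, hS', hmax⟩ := (hmem S).1 hS
    refine ⟨hS', fun σ hσ hle => ?_⟩
    obtain ⟨S₁, hS₁, hsol, hle₁⟩ := exists_candidate hI hσ
    exact hle₁.trans (hmax S₁ hS₁ hsol (hle.trans hle₁))

end ProblemCode

end Effectiveness

theorem mainTheorem9 {α : Type*} (rel : MatchRel) :
    -- solutions are bounded by finitely many maximal solutions, which are regular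
    (∀ P : MatchingProblem α, P.WellFormed → P.Regular →
      (∀ σ, P.IsSolution rel σ → ∃ τ, Maximal (P.IsSolution rel) τ ∧ σ ≤ τ) ∧
      {τ | Maximal (P.IsSolution rel) τ}.Finite ∧
      ∀ τ, Maximal (P.IsSolution rel) τ → ∀ x, (τ x).IsRegular) ∧
    -- for letters from an effectively coded set, everything is effective
    (∀ [Primcodable α],
      (∃ dec : ProblemCode α → Bool, Computable dec ∧
        ∀ I : ProblemCode α, I.toProblem.WellFormed →
          (dec I = true ↔ ∃ σ, I.toProblem.IsSolution rel σ)) ∧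
      ∃ solve : ProblemCode α → List (SubstCode α), Computable solve ∧
        ∀ I : ProblemCode α, I.toProblem.WellFormed →
          ∀ τ, Maximal (I.toProblem.IsSolution rel) τ ↔
            ∃ S ∈ solve I, τ = S.toSubst I.toProblem.X) := by
  refine ⟨fun P hP hreg => MatchingProblem.maximal_solutions hP hreg rel, ?_⟩
  intro _
  have : DecidableEq α := Encodable.decidableEqOfEncodable α
  exact ⟨⟨ProblemCode.hasSolution rel, (ProblemCode.primrec_hasSolution rel).to_comp,
      fun I hI => ProblemCode.hasSolution_iff hI⟩,
    ProblemCode.maximalSolutions rel, (ProblemCode.primrec_maximalSolutions rel).to_comp,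
    fun I hI τ => ProblemCode.maximal_iff_mem_maximalSolutions hI⟩
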